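/- Let $D=\{1,\dots,\mathbf m\}\times\{1,\dots,\mathbf n\}$, let $A$ be a non-zero $0$-$1$ matrix indexed by $D$ which is irreducible on the set of digits whose row or column in $A$ is not zero, let $Z=\{z\in D^{\mathbb N}: A(z_i,z_{i+1})=1 \text{ for all } i\}$, let $\pi_y$ be the map that keeps the second coordinate of each digit, and let $Y=\pi_y(Z)$. Let $N_{ij}=[A((p,i),(q,j))]_{p,q=1}^{\mathbf m}$ be the induced matrix-valued potential, put $N_J=N_{j_0j_1}\cdots N_{j_{s-1}j_s}$ for a word $J=j_0\dots j_s$, let $\|\cdot\|$ be the sum of the entries, and for a shift-invariant Borel probability measure $\eta$ on $Y$ put $N_*(\eta)=\lim_{s\to\infty}\frac1{s+1}\int\log\|N_{y_0\dots y_s}\|\,d\eta(y)$. For $k\ge1$ let $Y_k$ be the set of words of length $k$ that occur in $Y$. Let $A^{[k]}$ be the $k$-th higher block matrix of $A$: for words $d,d'\in D^k$, $A^{[k]}(d,d')=1$ if there is a word $w_0\dots w_k$ with all $A(w_i,w_{i+1})=1$, $d=w_0\dots w_{k-1}$ and $d'=w_1\dots w_k$, and $A^{[k]}(d,d')=0$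 otherwise. For $J=j_0\dots j_k$ let $N^{[k]}_J$ be the $\mathbf m^k\times\mathbf m^k$ block of $A^{[k]}$ whose rows are the words of $D^k$ with second coordinates $J(0,k-1)=j_0\dots j_{k-1}$ and whose columns are those with second coordinates $J(1,k)=j_1\dots j_k$. Suppose that $N$ satisfies the Markov condition of order $k$ with coefficients $m(J,J')$. That is, for each $J\in Y_k$ there is a vector $V_J\in\mathbb R^{\mathbf m^k}$ with nonnegative entries, not identically zero on the coordinates $u$ for which the word of digits with first coordinates $u$ and second coordinates $J$ occurs in $Z$, and there are real numbers $m(\cdot,\cdot)$, such that, whenever $J(0,k-1),J(1,k)\in Y_k$, $$V_{J(0,k-1)}\,N^{[k]}_{J(0,k)}=m\bigl(J(0,k-1),J(1,k)\bigr)\,V_{J(1,k)}$$ with the $V$'s as row vectors (condition from the left), or the same with all arrows reversed, $N^{[k]}_{J(0,k)}V_{J(1,k)}=m(J(0,k-1),J(1,k))V_{J(0,k-1)}$ with the $V$'s as column vectors (condition from the right). Let $M=[m(J,J')]_{J,J'\in Y_k}$, with entry $0$ where $J'$ is not obtained from $J$ by deleting the first letter and appending a letter. Then the potential $N$ has exactly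 one equilibrium measure $\nu$ on $Y$ (the unique maximizer of $h_\eta+N_*(\eta)$ over the shift-invariant probability measures $\eta$ on $Y$), $Z$ has exactly one measure of maximal entropy, and $\nu$ is its image under $\pi_y$. The matrix $M$ is nonnegative, and $\nu$, regarded through the $k$-block presentation $y\mapsto(y_i\dots y_{i+k-1})_{i\ge0}$, is the unique measure of maximal entropy of the subshift of finite type $X_M=\{x\in Y_k^{\mathbb N}: M(x_i,x_{i+1})\ne0\text{ for all }i\}$, a transition from $J$ to $J'$ being counted with multiplicity $m(J,J')$: it is the unique maximizer of $h_\eta+\int\log M(x_0,x_1)\,d\eta(x)$ over the shift-invariant probability measures $\eta$ on $X_M$ (this functional is the ordinary entropy if $M$ is a $0$-$1$ matrix). It is the Parry measure of $M$: there are $\rho>0$ and nonnegative vectors $l,r$ with $lM=\rho l$, $Mr=\rho r$, $l\cdot r=1$ such that the cylinder of $w_0\dots w_s$ has measure $\rho^{-s}\,l(w_0)\,M(w_0,w_1)\cdots M(w_{s-1},w_s)\,r(w_s)$. Moreover, if all entries of $M$ are integers, then the edge shift of the multigraph with adjacency matrix $M$ has exactly one measure of (ordinary) maximal entropy, and $\nu$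 (in its $k$-block presentation) is the image of that measure under the map that replaces each edge by its initial vertex. -/

import Mathlib

open MeasureTheory Filter

namespace Carpet

noncomputable section

open Classical in
/-- The value at `w` of the 0-1 indicator of a proposition. -/
def ind (p : Prop) : ℝ := if p then 1 else 0

/-! ### One-sided shift spaces over a finite alphabet -/

/-- The shift map on one-sided sequences. -/
def shift {ι : Type*} (x : ℕ → ι) : ℕ → ι := fun i => x (i + 1)

/-- The one-sided subshift of finite type of the square matrix `M`: sequences all of whose
transitions have a non-zero entry in `M`. -/
def sft {ι : Type*} (M : Matrix ι ι ℝ) : Set (ℕ → ι) := {x | ∀ i, M (x i) (x (i + 1)) ≠ 0}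

/-- The words of length `r` that occur in some point of `X`. -/
def language {ι : Type*} (X : Set (ℕ → ι)) (r : ℕ) : Set (Fin r → ι) :=
  {w | ∃ x ∈ X, ∃ s : ℕ, ∀ t : Fin r, x (s + t) = w t}

/-- The cylinder of the points that begin with the word `w`. -/
def cylinder {ι : Type*} {r : ℕ} (w : Fin r → ι) : Set (ℕ → ι) := {x | ∀ t : Fin r, x t = w t}

/-- The shift-invariant Borel probability measures that live on `X`. -/
structure IsInvariantOn {ι : Type*} [MeasurableSpace ι] (X : Set (ℕ → ι))
    (μ : Measure (ℕ → ι)) : Prop where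
  prob : IsProbabilityMeasure μ
  invariant : MeasurePreserving shift μ μ
  supported : ∀ᵐ x ∂μ, x ∈ X

/-- The Shannon entropy of the partition into cylinders of length `r`. -/
def blockEntropy {ι : Type*} [Fintype ι] [MeasurableSpace ι] (μ : Measure (ℕ → ι)) (r : ℕ) : ℝ :=
  ∑ w : Fin r → ι, Real.negMulLog (μ.real (cylinder w))

/-- The entropy `h_μ` of the shift with respect to an invariant measure `μ`: the limit of
`blockEntropy μ r / r` (for invariant `μ` this sequence converges). -/
def entropy {ι : Type*} [Fintype ι] [MeasurableSpace ι] (μ : Measure (ℕ → ι)) : ℝ :=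
  limsup (fun r : ℕ => blockEntropy μ r / r) atTop

/-- `μ` is the one and only maximizer of `F` among the invariant probability measures on `X`. -/
def IsUniqueMaximizer {ι : Type*} [MeasurableSpace ι] (X : Set (ℕ → ι))
    (F : Measure (ℕ → ι) → ℝ) (μ : Measure (ℕ → ι)) : Prop :=
  IsInvariantOn X μ ∧ ∀ η, IsInvariantOn X η → η ≠ μ → F η < F μ

/-- The entropy of `μ` in the subshift of finite type of a nonnegative matrix `M`, where a
transition from `i` to `j` counts with multiplicity (weight) `M i j`. It is `entropy μ` if `M` is a
0-1 matrix. -/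
def weightedEntropy {ι : Type*} [Fintype ι] [MeasurableSpace ι] (M : Matrix ι ι ℝ)
    (μ : Measure (ℕ → ι)) : ℝ :=
  entropy μ + ∫ x, Real.log (M (x 0) (x 1)) ∂μ

/-- `μ` is the Parry measure of the nonnegative matrix `M`: with left and right eigenvectors `l`,
`r` for a positive eigenvalue `ρ`, normalized by `l ⬝ r = 1`, the cylinder of `w 0, …, w s` has
measure `ρ ^ (-s) * l (w 0) * M (w 0) (w 1) * ⋯ * M (w (s - 1)) (w s) * r (w s)`. -/
def IsParryMeasure {ι : Type*} [Fintype ι] [MeasurableSpace ι] (M : Matrix ι ι ℝ)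
    (μ : Measure (ℕ → ι)) : Prop :=
  ∃ (ρ : ℝ) (l r : ι → ℝ), 0 < ρ ∧ (∀ i, 0 ≤ l i) ∧ (∀ i, 0 ≤ r i) ∧
    Matrix.vecMul l M = ρ • l ∧ Matrix.mulVec M r = ρ • r ∧ l ⬝ᵥ r = 1 ∧
    ∀ (s : ℕ) (w : Fin (s + 1) → ι),
      μ.real (cylinder w) =
        (ρ ^ s)⁻¹ * l (w 0) * (∏ t : Fin s, M (w t.castSucc) (w t.succ)) * r (w (Fin.last s))

/-! ### Shifts of edges of a multigraph -/

/-- The edges of the multigraph with `a i j` edges from `i` to `j`. -/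
abbrev Edge {ι : Type*} (a : ι → ι → ℕ) : Type _ := Σ i : ι, Σ j : ι, Fin (a i j)

/-- The 0-1 matrix of the edge shift: `e` may be followed by `f` if `e` ends where `f` starts. -/
def edgeMatrix {ι : Type*} (a : ι → ι → ℕ) : Matrix (Edge a) (Edge a) ℝ :=
  fun e f => ind (e.2.1 = f.1)

/-- The sequence of initial vertices of a sequence of edges. -/
def vertexMap {ι : Type*} (a : ι → ι → ℕ) (x : ℕ → Edge a) : ℕ → ι := fun i => (x i).1

/-! ### Carpets: the digits are the pairs in `Fin m × Fin n` -/

variable {m n : ℕ}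

/-- The digits whose row or column in `A` is not zero. -/
def usedDigits (A : Matrix (Fin m × Fin n) (Fin m × Fin n) ℝ) : Set (Fin m × Fin n) :=
  {d | (∃ d', A d d' ≠ 0) ∨ ∃ d', A d' d ≠ 0}

/-- The factor map `π_y`, which keeps the second coordinate of each digit. -/
def projY (z : ℕ → Fin m × Fin n) : ℕ → Fin n := fun i => (z i).2

/-- The factor `Y = π_y(Z)` of the carpet `Z`, the subshift of finite type of `A`. -/
def factorY (A : Matrix (Fin m × Fin n) (Fin m × Fin n) ℝ) : Set (ℕ → Fin n) :=
  projY '' sft A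

/-- The induced matrix-valued potential: `N i j` is the block of `A` between the digits with second
coordinate `i` and those with second coordinate `j`. -/
def inducedPotential (A : Matrix (Fin m × Fin n) (Fin m × Fin n) ℝ) (i j : Fin n) :
    Matrix (Fin m) (Fin m) ℝ :=
  fun p q => A (p, i) (q, j)

/-- The product `N_J` of the potential along the word `J = J 0 … J s`. -/
def potentialProd (A : Matrix (Fin m × Fin n) (Fin m × Fin n) ℝ) {s : ℕ}
    (J : Fin (s + 1) → Fin n) : Matrix (Fin m) (Fin m) ℝ :=
  (List.ofFn fun t : Fin s => inducedPotential A (J t.castSucc) (J t.succ)).prod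

/-- The norm of a nonnegative matrix: the sum of its entries. -/
def entrySum (B : Matrix (Fin m) (Fin m) ℝ) : ℝ := ∑ p, ∑ q, B p q

/-- `N_*(μ)`, the limit of the means of `log ‖N_J‖` over the words `J` of length `s + 1`, divided
by the length. -/
def potentialEnergy (A : Matrix (Fin m × Fin n) (Fin m × Fin n) ℝ)
    (μ : Measure (ℕ → Fin n)) : ℝ :=
  limsup (fun s : ℕ =>
    (∫ y, Real.log (entrySum (potentialProd A (fun t : Fin (s + 1) => y t))) ∂μ) / (s + 1)) atTop

/-- `ν` is the unique equilibrium measure on `Y` of the induced potential. -/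
def IsUniqueEquilibrium (A : Matrix (Fin m × Fin n) (Fin m × Fin n) ℝ)
    (ν : Measure (ℕ → Fin n)) : Prop :=
  IsUniqueMaximizer (factorY A) (fun η => entropy η + potentialEnergy A η) ν

/-- The `k`-th higher block matrix of `A`: a transition between words of length `k` for each
word of length `k + 1` allowed by `A`. -/
def higherBlock (A : Matrix (Fin m × Fin n) (Fin m × Fin n) ℝ) (k : ℕ) :
    Matrix (Fin k → Fin m × Fin n) (Fin k → Fin m × Fin n) ℝ :=
  fun d d' => ind (∃ w : Fin (k + 1) → Fin m × Fin n,
    (∀ t : Fin k, A (w t.castSucc) (w t.succ) ≠ 0) ∧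
      (∀ t : Fin k, w t.castSucc = d t) ∧ ∀ t : Fin k, w t.succ = d' t)

/-- The word `J(0, k-1)` of a word `J` of length `k + 1`. -/
def initWord {ι : Type*} {k : ℕ} (J : Fin (k + 1) → ι) : Fin k → ι := fun t => J t.castSucc

/-- The word `J(1, k)` of a word `J` of length `k + 1`. -/
def tailWord {ι : Type*} {k : ℕ} (J : Fin (k + 1) → ι) : Fin k → ι := fun t => J t.succ

/-- The word of digits with first coordinates `u` and second coordinates `J`. -/
def pairWord {k : ℕ} (u : Fin k → Fin m) (J : Fin k → Fin n) : Fin k → Fin m × Fin n :=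
  fun t => (u t, J t)

/-- The `k`-th higher block induced potential: the block of `higherBlock A k` between the words
over `J(0, k-1)` and those over `J(1, k)`. -/
def higherPotential (A : Matrix (Fin m × Fin n) (Fin m × Fin n) ℝ) {k : ℕ}
    (J : Fin (k + 1) → Fin n) : Matrix (Fin k → Fin m) (Fin k → Fin m) ℝ :=
  fun u v => higherBlock A k (pairWord u (initWord J)) (pairWord v (tailWord J))

/-- The vectors `V J`, `J ∈ Y_k`, are nonnegative and do not vanish identically on the words of
the carpet above `J`. -/
structure IsAdmissibleFamily (A : Matrix (Fin m × Fin n) (Fin m × Fin n) ℝ) (k : ℕ)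
    (V : (Fin k → Fin n) → (Fin k → Fin m) → ℝ) : Prop where
  nonneg : ∀ J ∈ language (factorY A) k, ∀ u, 0 ≤ V J u
  nonzero : ∀ J ∈ language (factorY A) k, ∃ u, pairWord u J ∈ language (sft A) k ∧ V J u ≠ 0

/-- The Markov condition from the left of order `k`, with (row) vectors `V` and coefficients `c`. -/
structure MarkovLeft (A : Matrix (Fin m × Fin n) (Fin m × Fin n) ℝ) (k : ℕ)
    (V : (Fin k → Fin n) → (Fin k → Fin m) → ℝ)
    (c : (Fin k → Fin n) → (Fin k → Fin n) → ℝ) : Prop where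
  family : IsAdmissibleFamily A k V
  transfer : ∀ J : Fin (k + 1) → Fin n,
    initWord J ∈ language (factorY A) k → tailWord J ∈ language (factorY A) k →
      Matrix.vecMul (V (initWord J)) (higherPotential A J) =
        c (initWord J) (tailWord J) • V (tailWord J)

/-- The Markov condition from the right of order `k`: the same with transposed matrices, that is,
with column vectors `V` and all arrows reversed. -/
structure MarkovRight (A : Matrix (Fin m × Fin n) (Fin m × Fin n) ℝ) (k : ℕ)
    (V : (Fin k → Fin n) → (Fin k → Fin m) → ℝ)
    (c : (Fin k → Fin n) → (Fin k → Fin n) → ℝ) : Prop where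
  family : IsAdmissibleFamily A k V
  transfer : ∀ J : Fin (k + 1) → Fin n,
    initWord J ∈ language (factorY A) k → tailWord J ∈ language (factorY A) k →
      Matrix.mulVec (higherPotential A J) (V (tailWord J)) =
        c (initWord J) (tailWord J) • V (initWord J)

open Classical in
/-- The matrix `M = [c(J, J')]` over `Y_k`, with entry `0` where `J'` cannot follow `J` by a shift
of one letter. It is extended by zero to all words of length `k`; words outside `Y_k` have zero rows
and columns, so they occur in no point of `sft M`. -/
def coeffMatrix (A : Matrix (Fin m × Fin n) (Fin m × Fin n) ℝ) (k : ℕ)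
    (c : (Fin k → Fin n) → (Fin k → Fin n) → ℝ) : Matrix (Fin k → Fin n) (Fin k → Fin n) ℝ :=
  fun J J' =>
    if J ∈ language (factorY A) k ∧ J' ∈ language (factorY A) k ∧
        ∃ w : Fin (k + 1) → Fin n, initWord w = J ∧ tailWord w = J'
    then c J J' else 0

/-- The `k`-block presentation of a sequence. -/
def blockMap (k : ℕ) (y : ℕ → Fin n) : ℕ → (Fin k → Fin n) := fun i t => y (i + t)

end

end Carpet

/-!
The Perron eigenvectors `l`, `r` of an irreducible nonnegative matrix `M` define its Parry
measure, a Markov chain with transition probabilities `M i j * r j / (ρ * r i)`. For an invariant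
measure `η` on `sft M`, the conditional entropy of a letter given the `s + 1` preceding ones plus
`∫ log M` falls short of `log ρ` by exactly the mean relative entropy of the next letter with
respect to those probabilities (`PerronData.blockEntropy_add_integral`). As the conditional
entropies decrease to `entropy η`, the supremum `log ρ` is attained if and only if all these
relative entropies vanish, which makes `η` the Parry measure (`PerronData.isUniqueMaximizer`).

Let `E = higherBlock A k`, and let `V` be the vectors of the Markov condition, seen as one
function on words of digits. The condition from the left says that `E` lumps to
`M = coeffMatrix A k c`: the `V`-weighted sums of the columns of `E` over the fibres of the
projection are `∑ V e * E e f = M i (φ f) * V f`. By irreducibility `V` is positive on the words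
that occur, so `M` is irreducible with `M (φ e) (φ f) ≠ 0` whenever `E e f ≠ 0`. If `l` is the
left Perron eigenvector of `M`, then `(l ∘ φ) * V` is the one of `E`. Hence both matrices have the
same `ρ`, and summing path weights over fibres shows that the Parry measure of `E` projects to
that of `M` (`exists_lumped_of_left`, `IsLumped.hasParryCylinders`). The condition from the right
is the same for the transposed matrices and reversed words. The edge shift of an integral `M`
lumps to `M` with `V` constant (`PerronData.exists_edgeShift_maximizer`).

Block presentations preserve entropy (`entropy_map_blockSeq`), so the Parry measure of `E` is the
`k`-block presentation of the measure of maximal entropy `μ` of the carpet. Put `ν = π_y μ`. The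
measure of a cylinder of `ν` is, up to bounded factors and a power of `ρ`, both the number
`‖N_{y_0 … y_s}‖` of words of digits above it and the product of the entries of `M` along its
block presentation. Therefore `N_*(η)` is the integral of `log M` over the block presentation of
`η` (`potentialEnergy_eq_integral`), the two variational problems coincide, and `ν` solves both.
-/

namespace Carpet

open Finset

/-! ### Words, cylinders and paths -/

section Words

variable {ι : Type*}

/-- The first `r` letters of a sequence. -/
def take (r : ℕ) (x : ℕ → ι) : Fin r → ι := fun t => x t

theorem mem_cylinder {r : ℕ} {w : Fin r → ι} {x : ℕ → ι} : x ∈ cylinder w ↔ take r x = w :=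
  funext_iff.symm

theorem cylinder_eq_preimage {r : ℕ} (w : Fin r → ι) : cylinder w = take r ⁻¹' {w} := by
  ext x; simp [mem_cylinder]

theorem sum_snoc [Fintype ι] {r : ℕ} (f : (Fin (r + 1) → ι) → ℝ) :
    ∑ w, f w = ∑ w : Fin r → ι, ∑ j, f (Fin.snoc w j) := by
  rw [← (Fin.snocEquiv fun _ : Fin (r + 1) => ι).sum_comp, Fintype.sum_prod_type_right]
  rfl

theorem sum_cons [Fintype ι] {r : ℕ} (f : (Fin (r + 1) → ι) → ℝ) :
    ∑ w, f w = ∑ i, ∑ w : Fin r → ι, f (Fin.cons i w) := by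
  rw [← (Fin.consEquiv fun _ : Fin (r + 1) => ι).sum_comp, Fintype.sum_prod_type]
  rfl

/-- The product of the entries of `M` along the transitions of a word. -/
noncomputable def pathWeight (M : Matrix ι ι ℝ) {s : ℕ} (w : Fin (s + 1) → ι) : ℝ :=
  ∏ t : Fin s, M (w t.castSucc) (w t.succ)

theorem pathWeight_snoc (M : Matrix ι ι ℝ) {s : ℕ} (w : Fin (s + 1) → ι) (j : ι) :
    pathWeight M (Fin.snoc w j : Fin (s + 2) → ι) = pathWeight M w * M (w (Fin.last s)) j := by
  unfold pathWeight
  rw [Fin.prod_univ_castSucc]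
  simp only [Fin.snoc_castSucc, Fin.succ_castSucc, Fin.succ_last, Fin.snoc_last]

theorem pathWeight_cons (M : Matrix ι ι ℝ) {s : ℕ} (i : ι) (w : Fin (s + 1) → ι) :
    pathWeight M (Fin.cons i w : Fin (s + 2) → ι) = M i (w 0) * pathWeight M w := by
  unfold pathWeight
  rw [Fin.prod_univ_succ]
  simp

theorem pathWeight_nonneg {M : Matrix ι ι ℝ} (hM : ∀ i j, 0 ≤ M i j) {s : ℕ}
    (w : Fin (s + 1) → ι) : 0 ≤ pathWeight M w :=
  prod_nonneg fun _ _ => hM _ _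

/-- Reversing the arrows of the graph and the order of the letters leaves the weight unchanged. -/
theorem pathWeight_transpose_rev (M : Matrix ι ι ℝ) {s : ℕ} (w : Fin (s + 1) → ι) :
    pathWeight M.transpose (w ∘ Fin.rev) = pathWeight M w := by
  unfold pathWeight
  rw [← Equiv.prod_comp Fin.revPerm]
  refine prod_congr rfl fun t _ => ?_
  simp [Matrix.transpose_apply, Fin.rev_castSucc, Fin.rev_succ]

theorem snoc_zero {s : ℕ} (w : Fin (s + 1) → ι) (j : ι) :
    (Fin.snoc w j : Fin (s + 2) → ι) 0 = w 0 :=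
  Fin.snoc_castSucc (α := fun _ => ι) j w 0

theorem iterate_shift_apply (i : ℕ) (x : ℕ → ι) (t : ℕ) : shift^[i] x t = x (t + i) := by
  induction i generalizing x with
  | zero => rfl
  | succ i ih => rw [Function.iterate_succ_apply, ih]; simp [shift, add_assoc]

theorem mem_cylinder_snoc {r : ℕ} (w : Fin r → ι) (j : ι) (x : ℕ → ι) :
    x ∈ cylinder (Fin.snoc w j : Fin (r + 1) → ι) ↔ x ∈ cylinder w ∧ x r = j := by
  simp only [cylinder, Set.mem_ofPred_eq, Fin.forall_fin_succ', Fin.snoc_castSucc, Fin.snoc_last,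
    Fin.val_castSucc, Fin.val_last]

theorem mem_cylinder_cons {r : ℕ} (w : Fin r → ι) (i : ι) (x : ℕ → ι) :
    x ∈ cylinder (Fin.cons i w : Fin (r + 1) → ι) ↔ x 0 = i ∧ shift x ∈ cylinder w := by
  simp only [cylinder, Set.mem_ofPred_eq, Fin.forall_fin_succ, Fin.cons_zero, Fin.cons_succ,
    Fin.val_zero, Fin.val_succ, shift]

end Words

section Measures

variable {ι : Type*} [MeasurableSpace ι]

theorem measurable_take (r : ℕ) : Measurable (take r : (ℕ → ι) → _) :=
  measurable_pi_lambda _ fun _ => measurable_pi_apply _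

theorem measurable_shift : Measurable (shift : (ℕ → ι) → _) :=
  measurable_pi_lambda _ fun _ => measurable_pi_apply _

variable [Fintype ι] [DiscreteMeasurableSpace ι]

theorem measurableSet_cylinder {r : ℕ} (w : Fin r → ι) : MeasurableSet (cylinder w) := by
  rw [cylinder_eq_preimage]
  exact measurable_take r (measurableSet_singleton w)

theorem measurableSet_sft (M : Matrix ι ι ℝ) : MeasurableSet (sft M) := by
  have : sft M = ⋂ i, (fun x : ℕ → ι => (x i, x (i + 1))) ⁻¹' {p | M p.1 p.2 ≠ 0} := by
    ext x; simp [sft]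
  rw [this]
  exact MeasurableSet.iInter fun i =>
    ((measurable_pi_apply i).prodMk (measurable_pi_apply (i + 1))) (MeasurableSet.of_discrete)

theorem integral_take (μ : Measure (ℕ → ι)) [IsFiniteMeasure μ] {r : ℕ} (f : (Fin r → ι) → ℝ) :
    ∫ x, f (take r x) ∂μ = ∑ w, μ.real (cylinder w) * f w := by
  rw [← integral_map (measurable_take r).aemeasurable
    (Measurable.of_discrete.aestronglyMeasurable), integral_fintype (Integrable.of_finite)]
  refine sum_congr rfl fun w _ => ?_
  rw [smul_eq_mul, map_measureReal_apply (measurable_take r) (measurableSet_singleton w),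
    cylinder_eq_preimage]

theorem integrable_take (μ : Measure (ℕ → ι)) [IsFiniteMeasure μ] {r : ℕ}
    (f : (Fin r → ι) → ℝ) : Integrable (fun x => f (take r x)) μ :=
  (Integrable.of_finite (μ := μ.map (take r)) (f := f)).comp_measurable (measurable_take r)

theorem sum_real_cylinder (μ : Measure (ℕ → ι)) [IsProbabilityMeasure μ] (r : ℕ) :
    ∑ w : Fin r → ι, μ.real (cylinder w) = 1 := by
  have := integral_take μ (r := r) fun _ => 1
  simpa using this.symm

theorem sum_real_cylinder_snoc (μ : Measure (ℕ → ι)) [IsFiniteMeasure μ] {r : ℕ}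
    (w : Fin r → ι) : ∑ j, μ.real (cylinder (Fin.snoc w j : Fin (r + 1) → ι)) =
      μ.real (cylinder w) := by
  classical
  have h1 := integral_take μ (r := r + 1) fun v => if Fin.init v = w then 1 else 0
  have h2 := integral_take μ (r := r) fun v => if v = w then 1 else 0
  rw [sum_snoc] at h1
  simp only [Fin.init_snoc, mul_ite, mul_one, mul_zero, sum_ite_eq', mem_univ, if_true] at h1 h2
  rw [← h2]
  have h3 : ∀ x : ℕ → ι, Fin.init (take (r + 1) x) = take r x := fun _ => rfl
  simp only [h3] at h1
  rw [h1, sum_comm]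
  simp

theorem sum_real_cylinder_cons_eq_preimage (μ : Measure (ℕ → ι)) [IsFiniteMeasure μ] {r : ℕ}
    (w : Fin r → ι) : ∑ i, μ.real (cylinder (Fin.cons i w : Fin (r + 1) → ι)) =
      μ.real (shift ⁻¹' cylinder w) := by
  classical
  have h1 := integral_take μ (r := r + 1) fun v => if Fin.tail v = w then 1 else 0
  rw [sum_cons] at h1
  simp only [Fin.tail_cons, mul_ite, mul_one, mul_zero, sum_ite_eq', mem_univ, if_true] at h1
  rw [← h1]
  have h3 : (fun x : ℕ → ι => if Fin.tail (take (r + 1) x) = w then (1 : ℝ) else 0) =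
      (shift ⁻¹' cylinder w).indicator 1 := by
    ext x
    have : Fin.tail (take (r + 1) x) = take r (shift x) := rfl
    simp [Set.indicator_apply, mem_cylinder, this]
  rw [h3, integral_indicator_one (measurable_shift (measurableSet_cylinder w))]

theorem sum_real_cylinder_cons {μ : Measure (ℕ → ι)} [IsFiniteMeasure μ]
    (hμ : MeasurePreserving shift μ μ) {r : ℕ} (w : Fin r → ι) :
    ∑ i, μ.real (cylinder (Fin.cons i w : Fin (r + 1) → ι)) = μ.real (cylinder w) := by
  rw [sum_real_cylinder_cons_eq_preimage,
    hμ.measureReal_preimage (measurableSet_cylinder w).nullMeasurableSet]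

/-- The cylinders of nonempty words determine a probability measure. -/
theorem measure_ext_cylinder {μ ν : Measure (ℕ → ι)} [IsProbabilityMeasure μ]
    [IsProbabilityMeasure ν]
    (h : ∀ (s : ℕ) (w : Fin (s + 1) → ι), μ.real (cylinder w) = ν.real (cylinder w)) : μ = ν := by
  let C : Set (Set (ℕ → ι)) := {S | ∃ s, ∃ B : Set (Fin (s + 1) → ι), S = take (s + 1) ⁻¹' B}
  have hC : IsPiSystem C := by
    rintro _ ⟨s, B, rfl⟩ _ ⟨t, B', rfl⟩ -
    have h1 : s + 1 ≤ max s t + 1 := by omega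
    have h2 : t + 1 ≤ max s t + 1 := by omega
    exact ⟨max s t, {w | (fun i => w (Fin.castLE h1 i)) ∈ B ∧ (fun i => w (Fin.castLE h2 i)) ∈ B'},
      rfl⟩
  have hgen : (MeasurableSpace.pi : MeasurableSpace (ℕ → ι)) = MeasurableSpace.generateFrom C := by
    refine le_antisymm (iSup_le fun i => ?_) (MeasurableSpace.generateFrom_le ?_)
    · rintro _ ⟨B, -, rfl⟩
      exact MeasurableSpace.measurableSet_generateFrom ⟨i, {w | w (Fin.last i) ∈ B}, rfl⟩
    · rintro _ ⟨s, B, rfl⟩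
      exact measurable_take _ MeasurableSet.of_discrete
  refine ext_of_generate_finite C hgen hC ?_ (by simp)
  rintro _ ⟨s, B, rfl⟩
  have : μ.map (take (s + 1)) = ν.map (take (s + 1)) := by
    refine Measure.ext_of_singleton fun w => ?_
    rw [Measure.map_apply (measurable_take _) (measurableSet_singleton w),
      Measure.map_apply (measurable_take _) (measurableSet_singleton w), ← cylinder_eq_preimage]
    exact (measureReal_eq_measureReal_iff).1 (h s w)
  rw [← Measure.map_apply (measurable_take _) MeasurableSet.of_discrete, this,
    Measure.map_apply (measurable_take _) MeasurableSet.of_discrete]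

end Measures

instance {ι : Type*} [Fintype ι] [MeasurableSpace ι] [DiscreteMeasurableSpace ι] (a : ι → ι → ℕ) :
    DiscreteMeasurableSpace (Edge a) where
  forall_measurableSet s := by
    refine (MeasurableSpace.measurableSet_iInf).2 fun i => ?_
    refine (MeasurableSpace.measurableSet_iInf (α := Σ j, Fin (a i j))).2 fun j => ?_
    exact MeasurableSet.of_discrete (α := Fin (a i j))

/-! ### Entropy of invariant measures -/

/-- The summand of a relative entropy, corrected by the difference of masses, is nonnegative. -/
theorem gibbs_nonneg {x y : ℝ} (hx : 0 ≤ x) (hy : 0 ≤ y) (h : y = 0 → x = 0) :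
    0 ≤ x * Real.log x - x * Real.log y - x + y := by
  rcases hx.eq_or_lt with rfl | hx
  · simpa using hy
  have hy' : 0 < y := hy.lt_of_ne fun h' => hx.ne' (h h'.symm)
  have h1 := Real.log_le_sub_one_of_pos (div_pos hy' hx)
  rw [Real.log_div hy'.ne' hx.ne'] at h1
  have h2 := mul_le_mul_of_nonneg_left h1 hx.le
  have h3 : x * (y / x - 1) = y - x := by field_simp
  linarith

theorem gibbs_eq {x y : ℝ} (hx : 0 ≤ x) (hy : 0 ≤ y) (h : y = 0 → x = 0)
    (h0 : x * Real.log x - x * Real.log y - x + y = 0) : x = y := by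
  rcases hx.eq_or_lt with rfl | hx
  · simpa using h0.symm
  have hy' : 0 < y := hy.lt_of_ne fun h' => hx.ne' (h h'.symm)
  by_contra hne
  have h1 := Real.log_lt_sub_one_of_pos (div_pos hy' hx)
    (fun h1 => hne ((div_eq_one_iff_eq hx.ne').1 h1).symm)
  rw [Real.log_div hy'.ne' hx.ne'] at h1
  have h2 := mul_lt_mul_of_pos_left h1 hx
  have h3 : x * (y / x - 1) = y - x := by field_simp
  linarith

theorem real_cylinder_snoc_le {ι : Type*} [MeasurableSpace ι] (μ : Measure (ℕ → ι))
    [IsFiniteMeasure μ] {r : ℕ} (w : Fin r → ι) (j : ι) :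
    μ.real (cylinder (Fin.snoc w j : Fin (r + 1) → ι)) ≤ μ.real (cylinder w) :=
  measureReal_mono fun x hx => ((mem_cylinder_snoc w j x).1 hx).1

theorem blockEntropy_zero {ι : Type*} [Fintype ι] [MeasurableSpace ι] (μ : Measure (ℕ → ι))
    [IsProbabilityMeasure μ] :
    blockEntropy μ 0 = 0 := by
  have : ∀ w : Fin 0 → ι, cylinder w = Set.univ := fun w => by ext; simp [cylinder]
  simp [blockEntropy, this]

section

variable {ι : Type*} [Fintype ι] [MeasurableSpace ι] [DiscreteMeasurableSpace ι]

theorem real_cylinder_cons_le {μ : Measure (ℕ → ι)} [IsFiniteMeasure μ]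
    (hμ : MeasurePreserving shift μ μ) {r : ℕ} (w : Fin r → ι) (i : ι) :
    μ.real (cylinder (Fin.cons i w : Fin (r + 1) → ι)) ≤ μ.real (cylinder w) := by
  rw [← hμ.measureReal_preimage (measurableSet_cylinder w).nullMeasurableSet]
  exact measureReal_mono fun x hx => ((mem_cylinder_cons w i x).1 hx).2

/-- The increment of the block entropy is the conditional entropy of the last letter. -/
theorem blockEntropy_succ_sub (μ : Measure (ℕ → ι)) [IsFiniteMeasure μ] (r : ℕ) :
    blockEntropy μ (r + 1) - blockEntropy μ r =
      ∑ w : Fin r → ι, ∑ j, μ.real (cylinder (Fin.snoc w j : Fin (r + 1) → ι)) *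
        (Real.log (μ.real (cylinder w)) -
          Real.log (μ.real (cylinder (Fin.snoc w j : Fin (r + 1) → ι)))) := by
  unfold blockEntropy
  rw [sum_snoc, ← sum_sub_distrib]
  refine sum_congr rfl fun w _ => ?_
  simp only [Real.negMulLog, mul_sub, sum_sub_distrib, ← sum_mul, sum_real_cylinder_snoc,
    neg_mul, sum_neg_distrib]
  ring

theorem blockEntropy_le_succ (μ : Measure (ℕ → ι)) [IsFiniteMeasure μ] (r : ℕ) :
    0 ≤ blockEntropy μ (r + 1) - blockEntropy μ r := by
  rw [blockEntropy_succ_sub]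
  refine sum_nonneg fun w _ => sum_nonneg fun j _ => ?_
  rcases (measureReal_nonneg (μ := μ)
    (s := cylinder (Fin.snoc w j : Fin (r + 1) → ι))).eq_or_lt with h | h
  · simp [← h]
  · exact mul_nonneg h.le (sub_nonneg.2 (Real.log_le_log h (real_cylinder_snoc_le μ w j)))

/-- Conditioning on a longer past decreases the entropy. -/
theorem antitone_blockEntropy_succ_sub {μ : Measure (ℕ → ι)} [IsProbabilityMeasure μ]
    (hμ : MeasurePreserving shift μ μ) :
    Antitone fun r => blockEntropy μ (r + 1) - blockEntropy μ r := by
  refine antitone_nat_of_succ_le fun r => ?_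
  rw [blockEntropy_succ_sub, blockEntropy_succ_sub, sum_cons, sum_comm]
  let p : (r : ℕ) → (Fin r → ι) → ℝ := fun _ w => μ.real (cylinder w)
  have hp0 : ∀ {r : ℕ} (w : Fin r → ι), 0 ≤ p _ w := fun w => measureReal_nonneg
  have hcons : ∀ {r : ℕ} (w : Fin r → ι), ∑ i, p _ (Fin.cons i w : Fin (r + 1) → ι) = p _ w :=
    fun w => sum_real_cylinder_cons hμ w
  have hsnoc : ∀ {r : ℕ} (w : Fin r → ι), ∑ j, p _ (Fin.snoc w j : Fin (r + 1) → ι) = p _ w :=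
    fun w => sum_real_cylinder_snoc μ w
  change ∑ u : Fin r → ι, ∑ i, ∑ j,
      p _ (Fin.snoc (Fin.cons i u : Fin (r + 1) → ι) j : Fin (r + 2) → ι) *
        (Real.log (p _ (Fin.cons i u : Fin (r + 1) → ι)) -
          Real.log (p _ (Fin.snoc (Fin.cons i u : Fin (r + 1) → ι) j : Fin (r + 2) → ι))) ≤
    ∑ u : Fin r → ι, ∑ j, p _ (Fin.snoc u j : Fin (r + 1) → ι) *
      (Real.log (p _ u) - Real.log (p _ (Fin.snoc u j : Fin (r + 1) → ι)))
  refine sum_le_sum fun u _ => ?_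
  simp only [← Fin.cons_snoc_eq_snoc_cons]
  -- The law of `i u j` is compared with the one that makes `i` and `j` independent given `u`.
  have key : ∀ i j, p _ (Fin.cons i (Fin.snoc u j : Fin (r + 1) → ι) : Fin (r + 2) → ι) *
        (Real.log (p _ (Fin.cons i u : Fin (r + 1) → ι)) -
          Real.log (p _ (Fin.cons i (Fin.snoc u j : Fin (r + 1) → ι) : Fin (r + 2) → ι))) ≤
      p _ (Fin.cons i (Fin.snoc u j : Fin (r + 1) → ι) : Fin (r + 2) → ι) *
        (Real.log (p _ u) - Real.log (p _ (Fin.snoc u j : Fin (r + 1) → ι))) -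
      p _ (Fin.cons i (Fin.snoc u j : Fin (r + 1) → ι) : Fin (r + 2) → ι) +
      p _ (Fin.cons i u : Fin (r + 1) → ι) * p _ (Fin.snoc u j : Fin (r + 1) → ι) / p _ u := by
    intro i j
    have h1 : p _ (Fin.cons i (Fin.snoc u j : Fin (r + 1) → ι) : Fin (r + 2) → ι) ≤
        p _ (Fin.snoc u j : Fin (r + 1) → ι) := real_cylinder_cons_le hμ _ i
    have h2 : p _ (Fin.cons i (Fin.snoc u j : Fin (r + 1) → ι) : Fin (r + 2) → ι) ≤
        p _ (Fin.cons i u : Fin (r + 1) → ι) := by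
      rw [Fin.cons_snoc_eq_snoc_cons]; exact real_cylinder_snoc_le μ _ j
    have h3 : p _ (Fin.cons i u : Fin (r + 1) → ι) ≤ p _ u := real_cylinder_cons_le hμ _ i
    have h0 := hp0 (Fin.cons i (Fin.snoc u j : Fin (r + 1) → ι) : Fin (r + 2) → ι)
    generalize p _ (Fin.cons i (Fin.snoc u j : Fin (r + 1) → ι) : Fin (r + 2) → ι) = x at *
    generalize p _ (Fin.snoc u j : Fin (r + 1) → ι) = b at *
    generalize p _ (Fin.cons i u : Fin (r + 1) → ι) = c at *
    generalize p _ u = d at *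
    rcases h0.eq_or_lt with rfl | hx
    · simp only [zero_mul, sub_zero, zero_add]
      exact div_nonneg (mul_nonneg h2 h1) (h2.trans h3)
    have hb := hx.trans_le h1
    have hc := hx.trans_le h2
    have hd := hc.trans_le h3
    have := gibbs_nonneg hx.le (y := c * b / d) (by positivity) (fun h => by
      exact absurd h (by positivity))
    rw [Real.log_div (by positivity) hd.ne', Real.log_mul hc.ne' hb.ne'] at this
    linarith
  refine (sum_le_sum fun i _ => sum_le_sum fun j _ => key i j).trans (le_of_eq ?_)
  have e1 : ∑ i, ∑ j, p _ (Fin.cons i (Fin.snoc u j : Fin (r + 1) → ι) : Fin (r + 2) → ι) =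
      p _ u := by
    rw [sum_comm]; simp only [hcons, hsnoc]
  have e2 : ∑ i, ∑ j, p _ (Fin.cons i u : Fin (r + 1) → ι) *
      p _ (Fin.snoc u j : Fin (r + 1) → ι) / p _ u = p _ u := by
    simp only [← sum_div, ← mul_sum, ← sum_mul, hcons, hsnoc]
    exact mul_self_div_self _
  simp only [sum_add_distrib, sum_sub_distrib, e1, e2]
  rw [sum_comm]
  simp only [← sum_mul, hcons]
  ring

/-- The entropy of an invariant measure is the limit of the conditional entropies. -/
theorem tendsto_blockEntropy_succ_sub {μ : Measure (ℕ → ι)} [IsProbabilityMeasure μ]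
    (hμ : MeasurePreserving shift μ μ) :
    Tendsto (fun r => blockEntropy μ (r + 1) - blockEntropy μ r) atTop (nhds (entropy μ)) ∧
      Tendsto (fun r : ℕ => blockEntropy μ r / r) atTop (nhds (entropy μ)) := by
  have h1 := tendsto_atTop_ciInf (antitone_blockEntropy_succ_sub hμ)
    ⟨0, by rintro _ ⟨r, rfl⟩; exact blockEntropy_le_succ μ r⟩
  have h2 := h1.cesaro
  simp only [sum_range_sub, blockEntropy_zero, sub_zero] at h2
  have h3 : Tendsto (fun r : ℕ => blockEntropy μ r / r) atTop
      (nhds (⨅ r, (blockEntropy μ (r + 1) - blockEntropy μ r))) := by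
    refine h2.congr fun r => ?_
    rw [div_eq_inv_mul]
  have h4 : entropy μ = _ := h3.limsup_eq
  rw [h4]
  exact ⟨h1, h3⟩

theorem entropy_le_blockEntropy_succ_sub {μ : Measure (ℕ → ι)} [IsProbabilityMeasure μ]
    (hμ : MeasurePreserving shift μ μ) (r : ℕ) :
    entropy μ ≤ blockEntropy μ (r + 1) - blockEntropy μ r :=
  (antitone_blockEntropy_succ_sub hμ).le_of_tendsto (tendsto_blockEntropy_succ_sub hμ).1 r

end

/-! ### Perron–Frobenius theory of irreducible nonnegative matrices -/

section Perron

variable {ι : Type*}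

/-- `M` is a nonnegative matrix, all transitions of which stay in the nonempty set `S`, and any two
elements of `S` are joined by a path of positive length. Keeping `S` as a subset of the index type
avoids passing to a submatrix. -/
structure IrreducibleOn (M : Matrix ι ι ℝ) (S : Set ι) : Prop where
  nonneg : ∀ i j, 0 ≤ M i j
  mem : ∀ i j, M i j ≠ 0 → i ∈ S ∧ j ∈ S
  conn : ∀ i ∈ S, ∀ j ∈ S, Relation.TransGen (fun a b => M a b ≠ 0) i j
  nonempty : S.Nonempty

theorem IrreducibleOn.transpose {M : Matrix ι ι ℝ} {S : Set ι} (h : IrreducibleOn M S) :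
    IrreducibleOn M.transpose S where
  nonneg i j := h.nonneg j i
  mem i j hij := (h.mem j i hij).symm
  conn i hi j hj := Relation.transGen_swap.1 (h.conn j hj i hi)
  nonempty := h.nonempty

/-- Positivity spreads along the arrows to all of `S`. -/
theorem IrreducibleOn.forall_of_step {M : Matrix ι ι ℝ} {S : Set ι} (h : IrreducibleOn M S)
    {P : ι → Prop} (hstep : ∀ i j, M i j ≠ 0 → P i → P j) (hex : ∃ i ∈ S, P i) :
    ∀ j ∈ S, P j := by
  obtain ⟨i, hi, hPi⟩ := hex
  intro j hj
  induction h.conn i hi j hj with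
  | single hab => exact hstep _ _ hab hPi
  | tail hab hbc ih => exact hstep _ _ hbc (ih (h.mem _ _ hbc).1)

theorem IrreducibleOn.exists_succ {M : Matrix ι ι ℝ} {S : Set ι} (h : IrreducibleOn M S)
    {i : ι} (hi : i ∈ S) : ∃ j, M i j ≠ 0 := by
  obtain ⟨j, hj, -⟩ := Relation.TransGen.head'_iff.1 (h.conn i hi i hi)
  exact ⟨j, hj⟩

variable [Fintype ι]

theorem IrreducibleOn.exists_pow_pos [DecidableEq ι] {M : Matrix ι ι ℝ} {S : Set ι}
    (h : IrreducibleOn M S) {i j : ι} (hi : i ∈ S) (hj : j ∈ S) : ∃ t : ℕ, 0 < (M ^ t) i j := by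
  induction h.conn i hi j hj with
  | single hab => exact ⟨1, by simpa using (h.nonneg _ _).lt_of_ne' hab⟩
  | @tail b c hab hbc ih =>
    obtain ⟨t, ht⟩ := ih (h.mem _ _ hbc).1
    refine ⟨t + 1, ?_⟩
    rw [pow_succ, Matrix.mul_apply]
    exact sum_pos' (fun b _ => mul_nonneg (Matrix.pow_apply_nonneg h.nonneg _ _ _) (h.nonneg _ _))
      ⟨b, mem_univ _, mul_pos ht ((h.nonneg _ _).lt_of_ne' hbc)⟩

/-- A matrix commuting with `M` that turns nonzero nonnegative vectors on `S` into vectors which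
are positive on `S`. -/
theorem IrreducibleOn.exists_positive_commute {M : Matrix ι ι ℝ} {S : Set ι}
    (h : IrreducibleOn M S) : ∃ B : Matrix ι ι ℝ, Commute B M ∧ (∀ i j, 0 ≤ B i j) ∧
      (∀ i ∈ S, ∀ j ∈ S, 0 < B i j) ∧ ∀ i, i ∉ S → ∀ j ∈ S, B i j = 0 := by
  classical
  have hex : ∀ p : ι × ι, ∃ t : ℕ, p.1 ∈ S → p.2 ∈ S → 0 < (M ^ t) p.1 p.2 := by
    rintro ⟨i, j⟩
    by_cases hij : i ∈ S ∧ j ∈ S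
    · obtain ⟨t, ht⟩ := h.exists_pow_pos hij.1 hij.2
      exact ⟨t, fun _ _ => ht⟩
    · exact ⟨0, fun h1 h2 => absurd ⟨h1, h2⟩ hij⟩
  choose T hT using hex
  have hpow := Matrix.pow_apply_nonneg h.nonneg
  have happ : ∀ i j, (∑ p, M ^ T p) i j = ∑ p, (M ^ T p) i j := fun i j => by
    rw [Matrix.sum_apply]
  refine ⟨∑ p, M ^ T p, Commute.sum_left _ _ _ fun p _ => (Commute.refl M).pow_left _, ?_, ?_, ?_⟩
  · intro i j
    rw [happ]
    exact sum_nonneg fun p _ => hpow _ _ _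
  · intro i hi j hj
    rw [happ]
    exact sum_pos' (fun p _ => hpow _ _ _) ⟨(i, j), mem_univ _, hT (i, j) hi hj⟩
  · intro i hi j hj
    rw [happ]
    refine sum_eq_zero fun p _ => ?_
    cases T p with
    | zero =>
      have : i ≠ j := fun hij => hi (hij ▸ hj)
      simp [this]
    | succ t =>
      rw [pow_succ', Matrix.mul_apply]
      refine sum_eq_zero fun a _ => ?_
      rw [by_contra fun hia => hi (h.mem i a hia).1, zero_mul]

/-- Existence of the Perron eigenvector: the maximal `ρ` with `ρ x ≤ M x` for some probability
vector `x` on `S` is attained at an eigenvector. -/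
theorem IrreducibleOn.exists_eigenvector {M : Matrix ι ι ℝ} {S : Set ι}
    (h : IrreducibleOn M S) : ∃ (ρ : ℝ) (x : ι → ℝ), 0 < ρ ∧ (∀ i ∈ S, 0 < x i) ∧
      (∀ i, i ∉ S → x i = 0) ∧ M.mulVec x = ρ • x := by
  classical
  obtain ⟨B, hBM, hB0, hBpos, hBz⟩ := h.exists_positive_commute
  -- The pairs of a probability vector `x` on `S` and `ρ ≥ 0` with `ρ x ≤ M x` form a compact set.
  let T : Set (ℝ × (ι → ℝ)) := {p | 0 ≤ p.1 ∧ p.2 ∈ stdSimplex ℝ ι ∧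
    (∀ i, i ∉ S → p.2 i = 0) ∧ ∀ i, p.1 * p.2 i ≤ M.mulVec p.2 i}
  have hTsub : T ⊆ Set.Icc 0 (∑ i, ∑ j, M i j) ×ˢ stdSimplex ℝ ι := by
    rintro ⟨ρ, x⟩ ⟨h1, h2, -, h4⟩
    refine ⟨⟨h1, ?_⟩, h2⟩
    change ρ ≤ _
    calc ρ = ∑ i, ρ * x i := by rw [← mul_sum, h2.2, mul_one]
      _ ≤ ∑ i, M.mulVec x i := sum_le_sum fun i _ => h4 i
      _ ≤ _ := sum_le_sum fun i _ => sum_le_sum fun j _ =>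
        mul_le_of_le_one_right (h.nonneg _ _) (by
          rw [← h2.2]; exact single_le_sum (fun a _ => h2.1 a) (mem_univ j))
  have hmulVec : ∀ i, Continuous fun p : ℝ × (ι → ℝ) => M.mulVec p.2 i := fun i => by
    simp only [Matrix.mulVec, dotProduct]
    fun_prop
  have hTclosed : IsClosed T := by
    have hT : T = {p | 0 ≤ p.1} ∩ (Prod.snd ⁻¹' stdSimplex ℝ ι ∩
        ((⋂ i, {p | i ∉ S → p.2 i = 0}) ∩ ⋂ i, {p | p.1 * p.2 i ≤ M.mulVec p.2 i})) := by
      ext p; simp [T]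
    rw [hT]
    refine (isClosed_le continuous_const continuous_fst).inter
      (((isClosed_stdSimplex ℝ ι).preimage continuous_snd).inter
        ((isClosed_iInter fun i => ?_).inter (isClosed_iInter fun i => ?_)))
    · by_cases hi : i ∈ S
      · simp [hi]
      · simp only [hi, not_false_eq_true, forall_const]
        exact isClosed_eq (by fun_prop) continuous_const
    · exact isClosed_le (by fun_prop) (hmulVec i)
  have hTc : IsCompact T := (isCompact_Icc.prod (isCompact_stdSimplex ℝ ι)).of_isClosed_subset
    hTclosed hTsub
  obtain ⟨i₀, hi₀⟩ := h.nonempty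
  have hMnn : ∀ x : ι → ℝ, (∀ i, 0 ≤ x i) → ∀ i, 0 ≤ M.mulVec x i := fun x hx i =>
    sum_nonneg fun j _ => mul_nonneg (h.nonneg _ _) (hx j)
  have hTne : T.Nonempty := by
    refine ⟨(0, Pi.single i₀ 1), le_rfl, single_mem_stdSimplex ℝ i₀, fun i hi => ?_, fun i => ?_⟩
    · have hne : i ≠ i₀ := fun hh => hi (hh ▸ hi₀)
      exact Pi.single_eq_of_ne hne 1
    · rw [zero_mul]
      exact hMnn _ (single_mem_stdSimplex ℝ i₀).1 i
  obtain ⟨⟨ρ, x⟩, ⟨hρ0, hx, hxS, hle⟩, hmax⟩ := hTc.exists_isMaxOn hTne continuous_fst.continuousOn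
  have hρ0 : 0 ≤ ρ := hρ0
  have hBspread : ∀ z : ι → ℝ, (∀ i, 0 ≤ z i) → (∀ i, i ∉ S → z i = 0) → (∃ j, z j ≠ 0) →
      (∀ i ∈ S, 0 < B.mulVec z i) ∧ ∀ i, i ∉ S → B.mulVec z i = 0 := by
    rintro z hz hzS ⟨j, hj⟩
    have hjS : j ∈ S := by_contra fun hj' => hj (hzS j hj')
    refine ⟨fun i hi => ?_, fun i hi => sum_eq_zero fun a _ => ?_⟩
    · exact sum_pos' (fun a _ => mul_nonneg (hB0 _ _) (hz a))
        ⟨j, mem_univ _, mul_pos (hBpos i hi j hjS) ((hz j).lt_of_ne' hj)⟩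
    · by_cases ha : a ∈ S
      · exact mul_eq_zero_of_left (hBz i hi a ha) _
      · exact mul_eq_zero_of_right _ (hzS a ha)
  have hxne : ∃ j, x j ≠ 0 := by
    by_contra! hall
    have := hx.2
    simp [hall] at this
  obtain ⟨hyS, hyS'⟩ := hBspread x hx.1 hxS hxne
  have heig : M.mulVec x = ρ • x := by
    by_contra hne
    -- Otherwise `B` makes the defect of `x` positive on all of `S`, and `B x` admits a larger `ρ`.
    let z : ι → ℝ := M.mulVec x - ρ • x
    have hz0 : ∀ i, 0 ≤ z i := fun i => sub_nonneg.2 (hle i)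
    have hzS : ∀ i, i ∉ S → z i = 0 := fun i hi => by
      have h1 : M.mulVec x i = 0 := sum_eq_zero fun a _ =>
        mul_eq_zero_of_left (by_contra fun hia => hi (h.mem i a hia).1) _
      have h2 : x i = 0 := hxS i hi
      simp [z, h1, h2]
    have hzne : ∃ j, z j ≠ 0 := by
      by_contra! hall
      exact hne (sub_eq_zero.1 (funext hall))
    obtain ⟨hBz1, -⟩ := hBspread z hz0 hzS hzne
    let y := B.mulVec x
    have hMy : M.mulVec y = B.mulVec z + ρ • y := by
      simp only [y, z, Matrix.mulVec_sub, Matrix.mulVec_smul, Matrix.mulVec_mulVec, hBM.eq]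
      abel
    have hev : ∀ᶠ ε in nhdsWithin (0 : ℝ) (Set.Ioi 0), ∀ i, (ρ + ε) * y i ≤ M.mulVec y i := by
      refine eventually_all.2 fun i => ?_
      by_cases hi : i ∈ S
      · have hlt : (ρ + 0) * y i < M.mulVec y i := by
          rw [hMy]; simpa [Pi.add_apply] using hBz1 i hi
        have hcont : Continuous fun ε : ℝ => (ρ + ε) * y i := by fun_prop
        exact (((hcont.tendsto 0).eventually_lt_const hlt).filter_mono nhdsWithin_le_nhds).mono
          fun _ => le_of_lt
      · refine Eventually.of_forall fun ε => ?_
        have hy0 : y i = 0 := hyS' i hi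
        rw [hy0, mul_zero]
        exact sum_nonneg fun a _ => mul_nonneg (h.nonneg _ _) (by
          by_cases ha : a ∈ S
          · exact (hyS a ha).le
          · exact (hyS' a ha).ge)
    obtain ⟨ε, hε, hε0⟩ := (hev.and self_mem_nhdsWithin).exists
    have hε0 : 0 < ε := hε0
    have hynn : ∀ i, 0 ≤ y i := fun i => by
      by_cases hi : i ∈ S
      · exact (hyS i hi).le
      · exact (hyS' i hi).ge
    have hsum : 0 < ∑ i, y i := sum_pos' (fun i _ => hynn i) ⟨i₀, mem_univ _, hyS i₀ hi₀⟩
    have hmem : ((ρ + ε, (∑ i, y i)⁻¹ • y) : ℝ × (ι → ℝ)) ∈ T := by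
      refine ⟨by change 0 ≤ ρ + ε; positivity, ⟨fun i => ?_, ?_⟩, fun i hi => ?_, fun i => ?_⟩
      · exact mul_nonneg (inv_nonneg.2 hsum.le) (hynn i)
      · change ∑ i, (∑ i, y i)⁻¹ * y i = 1
        rw [← mul_sum, inv_mul_cancel₀ hsum.ne']
      · change (∑ i, y i)⁻¹ * y i = 0
        rw [show y i = 0 from hyS' i hi, mul_zero]
      · change (ρ + ε) * ((∑ i, y i)⁻¹ * y i) ≤ M.mulVec ((∑ i, y i)⁻¹ • y) i
        rw [Matrix.mulVec_smul]
        change _ ≤ (∑ i, y i)⁻¹ * M.mulVec y i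
        rw [mul_left_comm]
        exact mul_le_mul_of_nonneg_left (hε i) (inv_nonneg.2 hsum.le)
    have := hmax hmem
    have hle' : ρ + ε ≤ ρ := this
    linarith
  have hMx : ∀ i, M.mulVec x i = ρ * x i := fun i => congrFun heig i
  have hpos : ∀ i ∈ S, 0 < x i := by
    obtain ⟨j, hj⟩ := hxne
    have hjS : j ∈ S := by_contra fun hj' => hj (hxS j hj')
    refine h.transpose.forall_of_step (P := fun i => 0 < x i) (fun j i hij hj => ?_)
      ⟨j, hjS, (hx.1 j).lt_of_ne' hj⟩
    have h1 : 0 < M.mulVec x i := sum_pos' (fun a _ => mul_nonneg (h.nonneg _ _) (hx.1 a))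
      ⟨j, mem_univ _, mul_pos ((h.nonneg i j).lt_of_ne' hij) hj⟩
    rw [hMx] at h1
    exact pos_of_mul_pos_right h1 hρ0
  refine ⟨ρ, x, ?_, hpos, hxS, heig⟩
  obtain ⟨j, hj⟩ := h.exists_succ hi₀
  have h1 : 0 < M.mulVec x i₀ := sum_pos' (fun a _ => mul_nonneg (h.nonneg _ _) (hx.1 a))
    ⟨j, mem_univ _, mul_pos ((h.nonneg i₀ j).lt_of_ne' hj) (hpos j (h.mem _ _ hj).2)⟩
  rw [hMx] at h1
  exact pos_of_mul_pos_left h1 (hx.1 i₀)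

/-- `l` and `r` are the left and right Perron eigenvectors of `M`, normalized by `l ⬝ r = 1`. -/
structure PerronData (M : Matrix ι ι ℝ) (S : Set ι) (ρ : ℝ) (l r : ι → ℝ) : Prop where
  rho_pos : 0 < ρ
  left_pos : ∀ i ∈ S, 0 < l i
  left_zero : ∀ i, i ∉ S → l i = 0
  right_pos : ∀ i ∈ S, 0 < r i
  right_zero : ∀ i, i ∉ S → r i = 0
  left_eq : Matrix.vecMul l M = ρ • l
  right_eq : Matrix.mulVec M r = ρ • r
  dot : l ⬝ᵥ r = 1

variable {M : Matrix ι ι ℝ} {S : Set ι} {ρ : ℝ} {l r : ι → ℝ}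

theorem PerronData.transpose (h : PerronData M S ρ l r) : PerronData M.transpose S ρ r l where
  rho_pos := h.rho_pos
  left_pos := h.right_pos
  left_zero := h.right_zero
  right_pos := h.left_pos
  right_zero := h.left_zero
  left_eq := by rw [Matrix.vecMul_transpose, h.right_eq]
  right_eq := by rw [Matrix.mulVec_transpose, h.left_eq]
  dot := by rw [dotProduct_comm, h.dot]

theorem PerronData.left_nonneg (h : PerronData M S ρ l r) (i : ι) : 0 ≤ l i := by
  by_cases hi : i ∈ S
  · exact (h.left_pos i hi).le
  · exact (h.left_zero i hi).ge

theorem PerronData.right_nonneg (h : PerronData M S ρ l r) (i : ι) : 0 ≤ r i :=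
  h.transpose.left_nonneg i

theorem PerronData.sum_left (h : PerronData M S ρ l r) (j : ι) : ∑ i, l i * M i j = ρ * l j :=
  congrFun h.left_eq j

theorem PerronData.sum_right (h : PerronData M S ρ l r) (i : ι) : ∑ j, M i j * r j = ρ * r i :=
  congrFun h.right_eq i

/-- Positive left and right eigenvectors have the same eigenvalue, and can be normalized. -/
theorem PerronData.of_eigenvectors (hS : S.Nonempty) {ρ' : ℝ} (hρ : 0 < ρ)
    (hl : ∀ i ∈ S, 0 < l i) (hl' : ∀ i, i ∉ S → l i = 0) (hr : ∀ i ∈ S, 0 < r i)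
    (hr' : ∀ i, i ∉ S → r i = 0) (hle : Matrix.vecMul l M = ρ • l)
    (hre : Matrix.mulVec M r = ρ' • r) :
    0 < l ⬝ᵥ r ∧ PerronData M S ρ l ((l ⬝ᵥ r)⁻¹ • r) := by
  have hpos : 0 < l ⬝ᵥ r := by
    obtain ⟨i, hi⟩ := hS
    refine sum_pos' (fun a _ => ?_) ⟨i, mem_univ _, mul_pos (hl i hi) (hr i hi)⟩
    by_cases ha : a ∈ S
    · exact (mul_pos (hl a ha) (hr a ha)).le
    · simp [hl' a ha]
  have heq : ρ = ρ' := by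
    have h1 := Matrix.dotProduct_mulVec l M r
    rw [hle, hre, dotProduct_smul, smul_dotProduct, smul_eq_mul, smul_eq_mul] at h1
    exact (mul_right_cancel₀ hpos.ne' h1).symm
  subst heq
  refine ⟨hpos, hρ, hl, hl', fun i hi => mul_pos (inv_pos.2 hpos) (hr i hi), fun i hi => ?_, hle,
    ?_, ?_⟩
  · simp [hr' i hi]
  · rw [Matrix.mulVec_smul, hre, smul_comm]
  · rw [dotProduct_smul, smul_eq_mul, inv_mul_cancel₀ hpos.ne']

/-- The left Perron eigenvector is unique up to a factor. -/
theorem PerronData.left_unique (h : PerronData M S ρ l r) (hM : IrreducibleOn M S) {v : ι → ℝ}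
    (hvS : ∀ i, i ∉ S → v i = 0) (hv : ∀ j, ∑ i, v i * M i j = ρ * v j)
    (hvr : v ⬝ᵥ r = 1) : v = l := by
  classical
  -- Subtract the largest multiple of `l` that leaves a nonnegative vector; a zero of it spreads.
  obtain ⟨i₀, hi₀, hmin⟩ := Set.exists_min_image S (fun i => v i / l i) (Set.toFinite S) hM.nonempty
  set t := v i₀ / l i₀ with ht
  have hz : ∀ i, 0 ≤ v i - t * l i := fun i => by
    by_cases hi : i ∈ S
    · exact sub_nonneg.2 ((le_div_iff₀ (h.left_pos i hi)).1 (hmin i hi))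
    · simp [hvS i hi, h.left_zero i hi]
  have hzM : ∀ j, ∑ i, (v i - t * l i) * M i j = ρ * (v j - t * l j) := fun j => by
    simp only [sub_mul, sum_sub_distrib, hv, mul_assoc, ← mul_sum, h.sum_left]
    ring
  have hall : ∀ i ∈ S, v i - t * l i = 0 := by
    refine hM.transpose.forall_of_step (fun j i hij hj => ?_) ⟨i₀, hi₀, ?_⟩
    · have hs := hzM j
      rw [hj, mul_zero] at hs
      have := (sum_eq_zero_iff_of_nonneg fun i _ => mul_nonneg (hz i) (hM.nonneg i j)).1 hs i
        (mem_univ i)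
      exact (mul_eq_zero.1 this).resolve_right hij
    · rw [ht, div_mul_cancel₀ _ (h.left_pos i₀ hi₀).ne', sub_self]
  have hvl : v = t • l := by
    ext i
    by_cases hi : i ∈ S
    · exact sub_eq_zero.1 (hall i hi)
    · simp [hvS i hi, h.left_zero i hi]
  rw [hvl, smul_dotProduct, h.dot, smul_eq_mul, mul_one] at hvr
  rw [hvl, hvr, one_smul]

end Perron

/-! ### The Parry measure -/

section Parry

variable {ι : Type*} [Fintype ι]

/-- The measure of a cylinder is `ρ ^ (-s) * l (w 0) * M (w 0) (w 1) * ⋯ * r (w s)`. -/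
def HasParryCylinders [MeasurableSpace ι] (M : Matrix ι ι ℝ) (ρ : ℝ) (l r : ι → ℝ)
    (μ : Measure (ℕ → ι)) : Prop :=
  ∀ (s : ℕ) (w : Fin (s + 1) → ι),
    μ.real (cylinder w) = (ρ ^ s)⁻¹ * l (w 0) * pathWeight M w * r (w (Fin.last s))

variable {M : Matrix ι ι ℝ} {S : Set ι} {ρ : ℝ} {l r : ι → ℝ}

open Classical in
/-- The transition probabilities `M i j * r j / (ρ * r i)` from `i ∈ S`; outside `S` the chain is
made to stay where it is. -/
noncomputable def PerronData.transitionPMF (h : PerronData M S ρ l r) (hM : ∀ i j, 0 ≤ M i j)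
    (i : ι) : PMF ι :=
  if hi : i ∈ S then
    PMF.ofFintype (fun j => ENNReal.ofReal (M i j * r j / (ρ * r i))) (by
      rw [← ENNReal.ofReal_sum_of_nonneg, ← sum_div, h.sum_right, div_self, ENNReal.ofReal_one]
      · exact (mul_pos h.rho_pos (h.right_pos i hi)).ne'
      · exact fun j _ => div_nonneg (mul_nonneg (hM i j) (h.right_nonneg j))
          (mul_nonneg h.rho_pos.le (h.right_nonneg i)))
  else PMF.pure i

/-- The stationary probabilities `l i * r i`. -/
noncomputable def PerronData.initialPMF (h : PerronData M S ρ l r) : PMF ι :=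
  PMF.ofFintype (fun i => ENNReal.ofReal (l i * r i)) (by
    rw [← ENNReal.ofReal_sum_of_nonneg fun i _ => mul_nonneg (h.left_nonneg i) (h.right_nonneg i)]
    have : ∑ i, l i * r i = 1 := h.dot
    rw [this, ENNReal.ofReal_one])

variable [MeasurableSpace ι] [DiscreteMeasurableSpace ι]

/-- A finite-state Markov chain realized as a measure on sequences. -/
theorem exists_markov_measure (p₀ : PMF ι) (P : ι → PMF ι) :
    ∃ μ : Measure (ℕ → ι), IsProbabilityMeasure μ ∧
      (∀ w : Fin 1 → ι, μ (cylinder w) = p₀ (w 0)) ∧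
      ∀ (s : ℕ) (w : Fin (s + 1) → ι) (j : ι),
        μ (cylinder (Fin.snoc w j : Fin (s + 2) → ι)) =
          P (w (Fin.last s)) j * μ (cylinder w) := by
  let κ : (n : ℕ) → ProbabilityTheory.Kernel (Π _ : Finset.Iic n, ι) ι := fun n =>
    ⟨fun x => (P (x ⟨n, by simp⟩)).toMeasure, Measurable.of_discrete⟩
  have hκ : ∀ n, ProbabilityTheory.IsMarkovKernel (κ n) := fun n =>
    ⟨fun x => PMF.toMeasure.isProbabilityMeasure (P (x ⟨n, by simp⟩))⟩
  let μ₀ : Measure ι := p₀.toMeasure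
  have hμ₀ : IsProbabilityMeasure μ₀ := PMF.toMeasure.isProbabilityMeasure p₀
  let μ : Measure (ℕ → ι) := ProbabilityTheory.Kernel.trajMeasure (X := fun _ => ι) μ₀ κ
  have hcyl : ∀ (s : ℕ) (w : Fin (s + 1) → ι), cylinder w =
      Preorder.frestrictLe (π := fun _ => ι) s ⁻¹'
        {fun i => w ⟨i.1, Nat.lt_succ_of_le (Finset.mem_Iic.1 i.2)⟩} := by
    intro s w
    ext x
    constructor
    · intro hx
      funext i
      exact hx ⟨i.1, Nat.lt_succ_of_le (Finset.mem_Iic.1 i.2)⟩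
    · intro hx t
      exact congrFun hx ⟨t.1, Finset.mem_Iic.2 (Nat.le_of_lt_succ t.2)⟩
  refine ⟨μ, inferInstance, fun w => ?_, fun s w j => ?_⟩
  · rw [hcyl, ← Measure.map_apply (by fun_prop) (measurableSet_singleton _)]
    have h0 : μ.map (Preorder.frestrictLe (π := fun _ => ι) 0) =
        μ₀.map (MeasurableEquiv.piUnique (fun _ : Finset.Iic 0 => ι)).symm := by
      change Measure.map _ (ProbabilityTheory.Kernel.trajMeasure (X := fun _ => ι) μ₀ κ) = _
      rw [ProbabilityTheory.Kernel.trajMeasure, Measure.map_comp _ _ (by fun_prop),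
        ProbabilityTheory.Kernel.traj_map_frestrictLe,
        ProbabilityTheory.Kernel.partialTraj_self, Measure.id_comp]
    rw [h0, Measure.map_apply (by fun_prop) (measurableSet_singleton _),
      ← PMF.toMeasure_apply_singleton p₀ (w 0) (measurableSet_singleton _)]
    congr 1
    ext a
    constructor
    · intro ha
      exact congrFun ha ⟨0, by simp⟩
    · intro ha
      funext i
      have hi : (⟨i.1, Nat.lt_succ_of_le (Finset.mem_Iic.1 i.2)⟩ : Fin 1) = 0 :=
        Subsingleton.elim _ _
      have ha : a = w 0 := ha
      change a = w _
      rw [hi, ha]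
  · have h1 := ProbabilityTheory.Kernel.map_frestrictLe_trajMeasure_compProd_eq_map_trajMeasure
      (X := fun _ => ι) (μ₀ := μ₀) (κ := κ) (a := s)
    let w' : (Π _ : Finset.Iic s, ι) :=
      fun i => w ⟨i.1, Nat.lt_succ_of_le (Finset.mem_Iic.1 i.2)⟩
    have h2 := congrArg (fun m => m ({w'} ×ˢ {j})) h1
    beta_reduce at h2
    rw [Measure.compProd_apply_prod (measurableSet_singleton _) (measurableSet_singleton _),
      lintegral_singleton, Measure.map_apply (by fun_prop)
      ((measurableSet_singleton _).prod (measurableSet_singleton _)),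
      Measure.map_apply (by fun_prop) (measurableSet_singleton _)] at h2
    have h3 : (fun x : ℕ → ι => (Preorder.frestrictLe (π := fun _ => ι) s x, x (s + 1))) ⁻¹'
        ({w'} ×ˢ {j}) = cylinder (Fin.snoc w j : Fin (s + 2) → ι) := by
      ext x
      rw [mem_cylinder_snoc, hcyl s w]
      rfl
    rw [h3, ← hcyl s w] at h2
    rw [← h2]
    congr 1
    exact PMF.toMeasure_apply_singleton (P (w (Fin.last s))) j (measurableSet_singleton j)

theorem PerronData.exists_measure (h : PerronData M S ρ l r) (hM : IrreducibleOn M S) :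
    ∃ μ : Measure (ℕ → ι), IsProbabilityMeasure μ ∧ HasParryCylinders M ρ l r μ := by
  obtain ⟨μ, hμ, h0, hsucc⟩ := exists_markov_measure h.initialPMF (h.transitionPMF hM.nonneg)
  refine ⟨μ, hμ, fun s => ?_⟩
  induction s with
  | zero =>
    intro w
    rw [measureReal_def, h0]
    simp [PerronData.initialPMF, pathWeight, mul_nonneg (h.left_nonneg _) (h.right_nonneg _)]
  | succ s ih =>
    intro w
    obtain ⟨w, j, rfl⟩ : ∃ (w' : Fin (s + 1) → ι) (j : ι), w = Fin.snoc w' j :=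
      ⟨Fin.init w, w (Fin.last _), (Fin.snoc_init_self w).symm⟩
    rw [measureReal_def, hsucc, ENNReal.toReal_mul, ← measureReal_def, ih, pathWeight_snoc,
      snoc_zero, Fin.snoc_last]
    by_cases hi : w (Fin.last s) ∈ S
    · have hr := (h.right_pos _ hi).ne'
      have hρ := h.rho_pos.ne'
      rw [PerronData.transitionPMF, dif_pos hi, PMF.ofFintype_apply,
        ENNReal.toReal_ofReal (div_nonneg (mul_nonneg (hM.nonneg _ _) (h.right_nonneg _))
        (mul_nonneg h.rho_pos.le (h.right_nonneg _)))]
      field_simp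
      ring
    · rw [h.right_zero _ hi, by_contra fun hj => hi (hM.mem (w (Fin.last s)) j hj).1]
      simp

variable {μ : Measure (ℕ → ι)}

theorem measurePreserving_shift_of_cylinder [IsProbabilityMeasure μ]
    (h : ∀ (s : ℕ) (w : Fin (s + 1) → ι),
      ∑ i, μ.real (cylinder (Fin.cons i w : Fin (s + 2) → ι)) = μ.real (cylinder w)) :
    MeasurePreserving shift μ μ := by
  refine ⟨measurable_shift, ?_⟩
  have := Measure.isProbabilityMeasure_map (μ := μ) measurable_shift.aemeasurable
  refine measure_ext_cylinder fun s w => ?_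
  rw [map_measureReal_apply measurable_shift (measurableSet_cylinder w), ← h,
    sum_real_cylinder_cons_eq_preimage]

theorem PerronData.isInvariantOn (h : PerronData M S ρ l r) [IsProbabilityMeasure μ]
    (hμ : HasParryCylinders M ρ l r μ) : IsInvariantOn (sft M) μ := by
  have hinv : MeasurePreserving shift μ μ := by
    refine measurePreserving_shift_of_cylinder fun s w => ?_
    rw [hμ]
    have : ∀ i, μ.real (cylinder (Fin.cons i w : Fin (s + 2) → ι)) =
        l i * M i (w 0) * ((ρ ^ (s + 1))⁻¹ * pathWeight M w * r (w (Fin.last s))) := fun i => by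
      rw [hμ, pathWeight_cons, Fin.cons_zero, ← Fin.succ_last, Fin.cons_succ]
      ring
    simp only [this, ← sum_mul, h.sum_left]
    have hρ := h.rho_pos.ne'
    field_simp
    ring
  refine ⟨inferInstance, hinv, ?_⟩
  refine ae_all_iff.2 fun i => ?_
  have h0 : ∀ᵐ x ∂μ, M (x 0) (x 1) ≠ 0 := by
    have hsub : {x : ℕ → ι | ¬ M (x 0) (x 1) ≠ 0} ⊆
        ⋃ p ∈ {p : ι × ι | M p.1 p.2 = 0}, cylinder ![p.1, p.2] := by
      intro x hx
      simp only [Set.mem_iUnion]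
      refine ⟨(x 0, x 1), not_not.1 hx, fun t => ?_⟩
      fin_cases t <;> rfl
    refine measure_mono_null hsub ((measure_biUnion_null_iff (Set.to_countable _)).2 ?_)
    intro p hp
    have hp : M p.1 p.2 = 0 := hp
    rw [← measureReal_eq_zero_iff, hμ]
    simp [pathWeight, hp]
  filter_upwards [(hinv.iterate i).quasiMeasurePreserving.ae h0] with x hx
  simpa [iterate_shift_apply, add_comm] using hx

end Parry

/-! ### The variational principle for the Parry measure -/

section Variational

theorem IsInvariantOn.exists_mem {ι : Type*} [MeasurableSpace ι] {M : Matrix ι ι ℝ}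
    {η : Measure (ℕ → ι)} (hη : IsInvariantOn (sft M) η) {s : ℕ} {w : Fin s → ι}
    (hw : η.real (cylinder w) ≠ 0) : ∃ x ∈ sft M, x ∈ cylinder w := by
  have := hη.prob
  have hw' : η (cylinder w) ≠ 0 := fun h => hw (by simp [measureReal_def, h])
  by_contra! hcon
  refine hw' (measure_mono_null ?_ hη.supported)
  exact fun x hx hxM => hcon x hxM hx

variable {ι : Type*} [Fintype ι] [MeasurableSpace ι] {M : Matrix ι ι ℝ} {S : Set ι} {ρ : ℝ}
  {l r : ι → ℝ} {η μ : Measure (ℕ → ι)}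

/-- The hypotheses of `gibbs_nonneg` for the law of the word `w j` and the one obtained from the law
of `w` by a Parry transition: where the latter vanishes, so does the former. -/
theorem PerronData.gibbs_term_nonneg (h : PerronData M S ρ l r) (hM : IrreducibleOn M S)
    (hη : IsInvariantOn (sft M) η) {s : ℕ} (w : Fin (s + 1) → ι) (j : ι) :
    0 ≤ η.real (cylinder w) * (M (w (Fin.last s)) j * r j / (ρ * r (w (Fin.last s)))) ∧
      (η.real (cylinder w) * (M (w (Fin.last s)) j * r j / (ρ * r (w (Fin.last s)))) = 0 →
        η.real (cylinder (Fin.snoc w j : Fin (s + 2) → ι)) = 0) := by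
  have hprob := hη.prob
  refine ⟨mul_nonneg measureReal_nonneg (div_nonneg (mul_nonneg (hM.nonneg _ _)
    (h.right_nonneg _)) (mul_nonneg h.rho_pos.le (h.right_nonneg _))), fun h0 => ?_⟩
  by_contra hw
  obtain ⟨x, hx, hxw⟩ := hη.exists_mem hw
  obtain ⟨hxw, hxj⟩ := (mem_cylinder_snoc w j x).1 hxw
  have hMx : M (w (Fin.last s)) j ≠ 0 := by
    rw [← hxw (Fin.last s), ← hxj]; exact hx s
  have hr := (h.right_pos _ (hM.mem _ _ hMx).1).ne'
  have hr' := (h.right_pos _ (hM.mem _ _ hMx).2).ne'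
  have hw' : η.real (cylinder w) ≠ 0 := fun h0 => hw (le_antisymm
    (h0 ▸ real_cylinder_snoc_le η w j) measureReal_nonneg)
  have hρ := h.rho_pos.ne'
  exact absurd h0 (by positivity)

variable [DiscreteMeasurableSpace ι]

/-- By invariance, the mean of `g` over the last transition of a word is its mean over the first. -/
theorem sum_mul_transition (hη : IsProbabilityMeasure η) (hinv : MeasurePreserving shift η η)
    (g : ι → ι → ℝ) (s : ℕ) :
    ∑ w : Fin (s + 1) → ι, ∑ j, η.real (cylinder (Fin.snoc w j : Fin (s + 2) → ι)) *
      g (w (Fin.last s)) j = ∫ x, g (x 0) (x 1) ∂η := by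
  have h1 := integral_take η (r := s + 2) fun v =>
    g (v (Fin.last s).castSucc) (v (Fin.last (s + 1)))
  rw [sum_snoc] at h1
  simp only [Fin.snoc_castSucc, Fin.snoc_last] at h1
  rw [← h1]
  have h2 := hinv.iterate s
  have h3 : AEStronglyMeasurable (fun x : ℕ → ι => g (x 0) (x 1)) η :=
    (integrable_take η (r := 2) fun v => g (v 0) (v 1)).aestronglyMeasurable
  conv_rhs => rw [← h2.map_eq]
  rw [integral_map h2.measurable.aemeasurable (by rwa [h2.map_eq])]
  simp only [iterate_shift_apply, take, Fin.val_castSucc, Fin.val_last, zero_add, add_comm 1 s]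

/-- The pressure `log ρ` exceeds the conditional entropy plus the mean of `log M` by the relative
entropy of the last transition with respect to the Parry transition probabilities. -/
theorem PerronData.blockEntropy_add_integral (h : PerronData M S ρ l r) (hM : IrreducibleOn M S)
    (hη : IsInvariantOn (sft M) η) (s : ℕ) :
    blockEntropy η (s + 2) - blockEntropy η (s + 1) + ∫ x, Real.log (M (x 0) (x 1)) ∂η =
      Real.log ρ - ∑ w : Fin (s + 1) → ι, ∑ j,
        (η.real (cylinder (Fin.snoc w j : Fin (s + 2) → ι)) *
            Real.log (η.real (cylinder (Fin.snoc w j : Fin (s + 2) → ι))) -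
          η.real (cylinder (Fin.snoc w j : Fin (s + 2) → ι)) *
            Real.log (η.real (cylinder w) *
              (M (w (Fin.last s)) j * r j / (ρ * r (w (Fin.last s))))) -
          η.real (cylinder (Fin.snoc w j : Fin (s + 2) → ι)) +
          η.real (cylinder w) * (M (w (Fin.last s)) j * r j / (ρ * r (w (Fin.last s))))) := by
  have hprob := hη.prob
  have hinv := hη.invariant
  -- The correction terms cancel, because the transition probabilities sum to one.
  have hq : ∀ w : Fin (s + 1) → ι,
      ∑ j, η.real (cylinder w) * (M (w (Fin.last s)) j * r j / (ρ * r (w (Fin.last s)))) =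
        η.real (cylinder w) := fun w => by
    by_cases hw : η.real (cylinder w) = 0
    · simp [hw]
    obtain ⟨x, hx, hxw⟩ := hη.exists_mem hw
    have hS : w (Fin.last s) ∈ S := by
      rw [← hxw (Fin.last s)]; exact (hM.mem _ _ (hx s)).1
    rw [← mul_sum, ← sum_div, h.sum_right, div_self, mul_one]
    exact (mul_pos h.rho_pos (h.right_pos _ hS)).ne'
  have hlog : ∀ (w : Fin (s + 1) → ι) (j : ι),
      η.real (cylinder (Fin.snoc w j : Fin (s + 2) → ι)) *
        Real.log (η.real (cylinder w) * (M (w (Fin.last s)) j * r j / (ρ * r (w (Fin.last s))))) =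
      η.real (cylinder (Fin.snoc w j : Fin (s + 2) → ι)) * Real.log (η.real (cylinder w)) +
      η.real (cylinder (Fin.snoc w j : Fin (s + 2) → ι)) * (Real.log (M (w (Fin.last s)) j) +
        Real.log (r j) - Real.log (r (w (Fin.last s))) - Real.log ρ) := fun w j => by
    by_cases hw : η.real (cylinder (Fin.snoc w j : Fin (s + 2) → ι)) = 0
    · simp [hw]
    obtain ⟨x, hx, hxw⟩ := hη.exists_mem hw
    obtain ⟨hxw, hxj⟩ := (mem_cylinder_snoc w j x).1 hxw
    have hMx : M (w (Fin.last s)) j ≠ 0 := by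
      rw [← hxw (Fin.last s), ← hxj]; exact hx s
    have hr := (h.right_pos _ (hM.mem _ _ hMx).1).ne'
    have hr' := (h.right_pos _ (hM.mem _ _ hMx).2).ne'
    have hw' : η.real (cylinder w) ≠ 0 := fun h0 => hw (le_antisymm
      (h0 ▸ real_cylinder_snoc_le η w j) measureReal_nonneg)
    have hρ := h.rho_pos.ne'
    rw [Real.log_mul hw' (by positivity), Real.log_div (by positivity) (by positivity),
      Real.log_mul hMx hr', Real.log_mul hρ hr]
    ring
  have hMr := sum_mul_transition hprob hinv
    (fun i j => Real.log (M i j) + Real.log (r j) - Real.log (r i) - Real.log ρ) s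
  have hint : ∀ g : ι → ι → ℝ, Integrable (fun x : ℕ → ι => g (x 0) (x 1)) η := fun g =>
    integrable_take η (r := 2) fun v => g (v 0) (v 1)
  have hsplit : ∫ x, (Real.log (M (x 0) (x 1)) + Real.log (r (x 1)) - Real.log (r (x 0)) -
      Real.log ρ) ∂η = ∫ x, Real.log (M (x 0) (x 1)) ∂η - Real.log ρ := by
    have e : ∫ x, Real.log (r (x 1)) ∂η = ∫ x, Real.log (r (x 0)) ∂η := by
      have h3 : AEStronglyMeasurable (fun x : ℕ → ι => Real.log (r (x 0))) η :=
        (hint fun i _ => Real.log (r i)).aestronglyMeasurable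
      conv_rhs => rw [← hinv.map_eq]
      rw [integral_map hinv.measurable.aemeasurable (by rwa [hinv.map_eq])]
      rfl
    rw [integral_sub, integral_sub, integral_add, e]
    · simp
    · exact hint fun i j => Real.log (M i j)
    · exact hint fun i j => Real.log (r j)
    · exact hint fun i j => Real.log (M i j) + Real.log (r j)
    · exact hint fun i j => Real.log (r i)
    · exact hint fun i j => Real.log (M i j) + Real.log (r j) - Real.log (r i)
    · exact integrable_const _
  rw [blockEntropy_succ_sub]
  simp only [hlog, sum_add_distrib, sum_sub_distrib, hq, mul_sub, sum_real_cylinder_snoc] at hMr ⊢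
  rw [hsplit] at hMr
  linarith

/-- A measure that attains the pressure is a Markov chain with the Parry transitions. -/
theorem PerronData.hasParryCylinders_of_le (h : PerronData M S ρ l r) (hM : IrreducibleOn M S)
    (hη : IsInvariantOn (sft M) η) (hle : Real.log ρ ≤ weightedEntropy M η) :
    HasParryCylinders M ρ l r η := by
  have hprob := hη.prob
  have hstep : ∀ (s : ℕ) (w : Fin (s + 1) → ι) (j : ι),
      η.real (cylinder (Fin.snoc w j : Fin (s + 2) → ι)) =
        η.real (cylinder w) * (M (w (Fin.last s)) j * r j / (ρ * r (w (Fin.last s)))) := by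
    intro s w j
    have h1 := entropy_le_blockEntropy_succ_sub hη.invariant (s + 1)
    have h2 := h.blockEntropy_add_integral hM hη s
    have hnn := fun (w : Fin (s + 1) → ι) (j : ι) =>
      gibbs_nonneg measureReal_nonneg (h.gibbs_term_nonneg hM hη w j).1
        (h.gibbs_term_nonneg hM hη w j).2
    have h3 := sum_nonneg fun (w : Fin (s + 1) → ι) (_ : w ∈ univ) =>
      sum_nonneg fun j (_ : j ∈ univ) => hnn w j
    unfold weightedEntropy at hle
    have h4 := le_antisymm (by linarith) h3
    have h5 := (sum_eq_zero_iff_of_nonneg fun w _ => sum_nonneg fun j _ => hnn w j).1 h4 w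
      (mem_univ w)
    have h6 := (sum_eq_zero_iff_of_nonneg fun j _ => hnn w j).1 h5 j (mem_univ j)
    exact gibbs_eq measureReal_nonneg (h.gibbs_term_nonneg hM hη w j).1
      (h.gibbs_term_nonneg hM hη w j).2 h6
  -- The one-letter distribution, divided by `r`, is a left eigenvector, hence equals `l`.
  have hS : ∀ i, i ∉ S → η.real (cylinder ![i]) = 0 := fun i hi => by
    by_contra hw
    obtain ⟨x, hx, hxw⟩ := hη.exists_mem hw
    have hx0 : x 0 = i := hxw 0
    exact hi (hx0 ▸ (hM.mem _ _ (hx 0)).1)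
  have hl : (fun i => η.real (cylinder ![i]) / r i) = l := by
    refine h.left_unique hM (fun i hi => by rw [hS i hi, zero_div]) (fun j => ?_) ?_
    · by_cases hj : j ∈ S
      · have h1 := sum_real_cylinder_cons hη.invariant ![j]
        have h2 : ∀ i, (Fin.cons i ![j] : Fin 2 → ι) = Fin.snoc ![i] j := fun i => by
          ext t; fin_cases t <;> rfl
        simp only [h2, hstep] at h1
        rw [← h1, sum_div, mul_sum]
        refine sum_congr rfl fun i _ => ?_
        have hr := (h.right_pos j hj).ne'
        have hρ := h.rho_pos.ne'
        have e : (![i] : Fin 1 → ι) (Fin.last 0) = i := rfl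
        rw [e]
        by_cases hi : r i = 0
        · simp [hi]
        · field_simp
      · rw [hS j hj, zero_div, mul_zero]
        refine sum_eq_zero fun i _ => ?_
        rw [by_contra fun hij => hj (hM.mem i j hij).2, mul_zero]
    · have h1 := sum_real_cylinder η 1
      rw [sum_snoc] at h1
      simp only [univ_unique, sum_singleton] at h1
      rw [← h1]
      change ∑ i, η.real (cylinder ![i]) / r i * r i = _
      refine sum_congr rfl fun i _ => ?_
      have e : (Fin.snoc (default : Fin 0 → ι) i : Fin 1 → ι) = ![i] := by
        ext t; fin_cases t; rfl
      rw [e]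
      by_cases hi : i ∈ S
      · exact div_mul_cancel₀ _ (h.right_pos i hi).ne'
      · rw [hS i hi, zero_div, zero_mul]
  intro s
  induction s with
  | zero =>
    intro w
    have hw : w = ![w 0] := by ext t; fin_cases t; rfl
    have e : w (Fin.last 0) = w 0 := rfl
    rw [e, ← hl, hw]
    simp only [pathWeight, pow_zero, inv_one, one_mul, univ_eq_empty, prod_empty, mul_one,
      Matrix.cons_val_zero]
    by_cases hi : w 0 ∈ S
    · rw [div_mul_cancel₀ _ (h.right_pos _ hi).ne']
    · rw [hS _ hi, zero_div, zero_mul]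
  | succ s ih =>
    intro w
    obtain ⟨w, j, rfl⟩ : ∃ (w' : Fin (s + 1) → ι) (j : ι), w = Fin.snoc w' j :=
      ⟨Fin.init w, w (Fin.last _), (Fin.snoc_init_self w).symm⟩
    rw [hstep, ih, pathWeight_snoc, snoc_zero, Fin.snoc_last]
    by_cases hi : w (Fin.last s) ∈ S
    · have hr := (h.right_pos _ hi).ne'
      have hρ := h.rho_pos.ne'
      field_simp
      ring
    · rw [h.right_zero _ hi, by_contra fun hj => hi (hM.mem (w (Fin.last s)) j hj).1]
      simp

theorem PerronData.weightedEntropy_eq (h : PerronData M S ρ l r) (hM : IrreducibleOn M S)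
    [IsProbabilityMeasure μ] (hμ : HasParryCylinders M ρ l r μ) :
    weightedEntropy M μ = Real.log ρ := by
  have hη := h.isInvariantOn hμ
  have hstep : ∀ (s : ℕ) (w : Fin (s + 1) → ι) (j : ι),
      μ.real (cylinder (Fin.snoc w j : Fin (s + 2) → ι)) =
        μ.real (cylinder w) * (M (w (Fin.last s)) j * r j / (ρ * r (w (Fin.last s)))) := by
    intro s w j
    rw [hμ, hμ, pathWeight_snoc, snoc_zero, Fin.snoc_last]
    by_cases hi : w (Fin.last s) ∈ S
    · have hr := (h.right_pos _ hi).ne'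
      have hρ := h.rho_pos.ne'
      field_simp
      ring
    · rw [h.right_zero _ hi, by_contra fun hj => hi (hM.mem (w (Fin.last s)) j hj).1]
      simp
  have hinc : ∀ s, blockEntropy μ (s + 1 + 1) - blockEntropy μ (s + 1) =
      Real.log ρ - ∫ x, Real.log (M (x 0) (x 1)) ∂μ := fun s => by
    have h2 := h.blockEntropy_add_integral hM hη s
    simp only [← hstep, sub_self, zero_sub, neg_add_cancel, sum_const_zero, sub_zero] at h2
    linarith
  have h1 := ((tendsto_add_atTop_iff_nat 1).2 (tendsto_blockEntropy_succ_sub hη.invariant).1)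
  simp only [hinc] at h1
  have := tendsto_nhds_unique h1 tendsto_const_nhds
  unfold weightedEntropy
  linarith

theorem HasParryCylinders.eq [IsProbabilityMeasure μ] [IsProbabilityMeasure η]
    (hμ : HasParryCylinders M ρ l r μ) (hη : HasParryCylinders M ρ l r η) : η = μ :=
  measure_ext_cylinder fun s w => by rw [hμ, hη]

/-- The Parry measure is the unique measure of maximal weighted entropy. -/
theorem PerronData.isUniqueMaximizer (h : PerronData M S ρ l r) (hM : IrreducibleOn M S)
    [IsProbabilityMeasure μ] (hμ : HasParryCylinders M ρ l r μ) :
    IsUniqueMaximizer (sft M) (weightedEntropy M) μ := by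
  refine ⟨h.isInvariantOn hμ, fun η hη hne => ?_⟩
  rw [h.weightedEntropy_eq hM hμ]
  by_contra! hle
  have := hη.prob
  exact hne (hμ.eq (h.hasParryCylinders_of_le hM hη hle))

/-- For a 0-1 matrix the weighted entropy is the entropy. -/
theorem PerronData.isUniqueMaximizer_entropy (h : PerronData M S ρ l r) (hM : IrreducibleOn M S)
    (h01 : ∀ i j, M i j ≠ 0 → M i j = 1) [IsProbabilityMeasure μ]
    (hμ : HasParryCylinders M ρ l r μ) : IsUniqueMaximizer (sft M) entropy μ := by
  have key : ∀ η, weightedEntropy M η = entropy η := fun η => by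
    have : ∀ x : ℕ → ι, Real.log (M (x 0) (x 1)) = 0 := fun x => by
      by_cases hx : M (x 0) (x 1) = 0
      · rw [hx, Real.log_zero]
      · rw [h01 _ _ hx, Real.log_one]
    simp [weightedEntropy, this]
  have := h.isUniqueMaximizer hM hμ
  rwa [funext key] at this

end Variational

/-! ### Lumping a Markov chain -/

section Lumping

variable {ι κ : Type*} [Fintype ι]

open Classical in
/-- The weights of the words over `w`, taken with respect to `E` and the boundary vectors `lE` and
`rE`, add up to the weight of `w` with respect to `M`, `lM` and `rM`. -/
def IsLumped (φ : ι → κ) (E : Matrix ι ι ℝ) (lE rE : ι → ℝ) (M : Matrix κ κ ℝ) (lM rM : κ → ℝ) :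
    Prop :=
  ∀ (s : ℕ) (w : Fin (s + 1) → κ),
    (∑ u : Fin (s + 1) → ι,
      if φ ∘ u = w then lE (u 0) * pathWeight E u * rE (u (Fin.last s)) else 0) =
      lM (w 0) * pathWeight M w * rM (w (Fin.last s))

variable {φ : ι → κ} {E : Matrix ι ι ℝ} {M : Matrix κ κ ℝ} {V : ι → ℝ} {S : Set ι} {ρ : ℝ}
  {lE rE : ι → ℝ} {lM rM : κ → ℝ}

theorem IsLumped.of_transpose
    (h : IsLumped φ E.transpose rE lE M.transpose rM lM) : IsLumped φ E lE rE M lM rM := by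
  classical
  intro s w
  have h1 := h s (w ∘ Fin.rev)
  rw [← (Equiv.arrowCongr (Fin.revPerm (n := s + 1)) (Equiv.refl ι)).sum_comp] at h1
  rw [pathWeight_transpose_rev] at h1
  simp only [Function.comp_apply, Fin.rev_zero, Fin.rev_last] at h1
  rw [mul_right_comm, mul_comm (lM _), mul_right_comm, ← h1]
  refine sum_congr rfl fun u _ => ?_
  have e : (Equiv.arrowCongr (Fin.revPerm (n := s + 1)) (Equiv.refl ι)) u = u ∘ Fin.rev := rfl
  have e2 : φ ∘ u ∘ Fin.rev = w ∘ Fin.rev ↔ φ ∘ u = w := by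
    constructor
    · intro h2
      have := congrArg (· ∘ Fin.rev) h2
      simpa [Function.comp_assoc, Fin.rev_involutive.comp_self] using this
    · intro h2; rw [← h2]; rfl
  rw [e, pathWeight_transpose_rev]
  simp only [e2, Function.comp_apply, Fin.rev_zero, Fin.rev_last]
  split_ifs
  · ring
  · rfl

open Classical in
/-- If the vectors `V` over each letter are mapped to multiples of one another by the blocks of
`E`, the path weights of `E` add up to those of the matrix of multipliers. -/
theorem sum_pathWeight_lump
    (hV : ∀ i f, (∑ e, if φ e = i then V e * E e f else 0) = M i (φ f) * V f) (s : ℕ) :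
    ∀ (w : Fin (s + 1) → κ) (g : ι → ℝ),
    (∑ u : Fin (s + 1) → ι,
      if φ ∘ u = w then V (u 0) * pathWeight E u * g (u (Fin.last s)) else 0) =
      pathWeight M w * ∑ e, if φ e = w (Fin.last s) then V e * g e else 0 := by
  induction s with
  | zero =>
    intro w g
    rw [← (Equiv.funUnique (Fin 1) ι).symm.sum_comp]
    simp only [pathWeight, univ_eq_empty, prod_empty, mul_one, one_mul]
    refine sum_congr rfl fun e _ => ?_
    have : φ ∘ (Equiv.funUnique (Fin 1) ι).symm e = w ↔ φ e = w (Fin.last 0) := by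
      rw [funext_iff]
      simp
    simp only [this]
    rfl
  | succ s ih =>
    intro w g
    obtain ⟨w, j, rfl⟩ : ∃ (w' : Fin (s + 1) → κ) (j : κ), w = Fin.snoc w' j :=
      ⟨Fin.init w, w (Fin.last _), (Fin.snoc_init_self w).symm⟩
    rw [sum_snoc]
    have hiff : ∀ (u : Fin (s + 1) → ι) (f : ι),
        φ ∘ (Fin.snoc u f : Fin (s + 2) → ι) = Fin.snoc w j ↔ φ ∘ u = w ∧ φ f = j := fun u f => by
      rw [Fin.comp_snoc, Fin.snoc_inj]
    have h1 : ∀ (u : Fin (s + 1) → ι), (∑ f, if φ ∘ (Fin.snoc u f : Fin (s + 2) → ι) = Fin.snoc w j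
        then V ((Fin.snoc u f : Fin (s + 2) → ι) 0) *
          pathWeight E (Fin.snoc u f : Fin (s + 2) → ι) *
          g ((Fin.snoc u f : Fin (s + 2) → ι) (Fin.last (s + 1))) else 0) =
        if φ ∘ u = w then V (u 0) * pathWeight E u *
          (∑ f, if φ f = j then E (u (Fin.last s)) f * g f else 0) else 0 := fun u => by
      simp only [hiff, snoc_zero, pathWeight_snoc, Fin.snoc_last]
      by_cases hu : φ ∘ u = w
      · simp only [hu, true_and, if_true, mul_sum, mul_ite, mul_zero, mul_assoc]
      · simp [hu]
    simp only [h1]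
    rw [ih w fun e => ∑ f, if φ f = j then E e f * g f else 0, pathWeight_snoc, Fin.snoc_last,
      mul_assoc]
    congr 1
    simp only [mul_sum, ← sum_filter]
    rw [sum_comm]
    simp only [sum_filter] at hV ⊢
    refine sum_congr rfl fun f _ => ?_
    by_cases hf : φ f = j
    · simp only [hf, if_true]
      rw [← mul_assoc, ← hf, ← hV, sum_mul]
      refine sum_congr rfl fun e _ => ?_
      split_ifs
      · ring
      · rw [zero_mul]
    · simp [hf]

open Classical in
theorem isLumped_of_left
    (hV : ∀ i f, (∑ e, if φ e = i then V e * E e f else 0) = M i (φ f) * V f)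
    (hl : ∀ e, lE e = lM (φ e) * V e) (hr : ∀ i, rM i = ∑ e, if φ e = i then V e * rE e else 0) :
    IsLumped φ E lE rE M lM rM := by
  intro s w
  rw [mul_assoc, hr, ← sum_pathWeight_lump hV, mul_sum]
  refine sum_congr rfl fun u _ => ?_
  split_ifs with hu
  · rw [hl, ← hu, Function.comp_apply]; ring
  · rw [mul_zero]

variable [Fintype κ]

open Classical in
/-- The matrix of multipliers is irreducible, and its left Perron eigenvector, spread over the
fibres of `φ` proportionally to `V`, is the left Perron eigenvector of `E`. -/
theorem exists_lumped_of_left (hE : IrreducibleOn E S) (hV0 : ∀ e, 0 ≤ V e)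
    (hVS : ∃ e ∈ S, 0 < V e) (hVz : ∀ e, e ∉ S → V e = 0)
    (hM : ∀ i j, M i j ≠ 0 → i ∈ φ '' S ∧ j ∈ φ '' S)
    (hV : ∀ i f, (∑ e, if φ e = i then V e * E e f else 0) = M i (φ f) * V f) :
    IrreducibleOn M (φ '' S) ∧ (∀ e f, E e f ≠ 0 → M (φ e) (φ f) ≠ 0) ∧
    ∃ ρ lE rE lM rM, PerronData E S ρ lE rE ∧ PerronData M (φ '' S) ρ lM rM ∧
      IsLumped φ E lE rE M lM rM := by
  have hnn : ∀ i f, ∀ e ∈ univ, 0 ≤ if φ e = i then V e * E e f else 0 := fun i f e _ => by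
    split_ifs
    · exact mul_nonneg (hV0 e) (hE.nonneg e f)
    · exact le_rfl
  have hstep : ∀ e f, E e f ≠ 0 → 0 < V e → 0 < M (φ e) (φ f) * V f := fun e f hef he => by
    rw [← hV]
    refine sum_pos' (hnn _ _) ⟨e, mem_univ _, ?_⟩
    rw [if_pos rfl]
    exact mul_pos he ((hE.nonneg e f).lt_of_ne' hef)
  have hVpos : ∀ e ∈ S, 0 < V e := hE.forall_of_step
    (fun e f hef he => (hV0 f).lt_of_ne' (right_ne_zero_of_mul (hstep e f hef he).ne')) hVS
  have hEM : ∀ e f, E e f ≠ 0 → M (φ e) (φ f) ≠ 0 := fun e f hef =>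
    left_ne_zero_of_mul (hstep e f hef (hVpos e (hE.mem e f hef).1)).ne'
  have hMirr : IrreducibleOn M (φ '' S) := by
    refine ⟨fun i j => ?_, hM, ?_, hE.nonempty.image φ⟩
    · by_cases hij : M i j = 0
      · exact hij.ge
      obtain ⟨f, hf, rfl⟩ := (hM i j hij).2
      have := sum_nonneg (hnn i f)
      rw [hV] at this
      exact nonneg_of_mul_nonneg_left this (hVpos f hf)
    · rintro _ ⟨e, he, rfl⟩ _ ⟨f, hf, rfl⟩
      exact (hE.conn e he f hf).lift φ fun a b hab => hEM a b hab
  refine ⟨hMirr, hEM, ?_⟩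
  obtain ⟨ρ, lM, hρ, hlpos, hlz, hle⟩ := hMirr.transpose.exists_eigenvector
  obtain ⟨ρ', r, hρ', hrpos, hrz, hre⟩ := hE.exists_eigenvector
  rw [Matrix.mulVec_transpose] at hle
  have hle' : ∀ j, ∑ i, lM i * M i j = ρ * lM j := fun j => congrFun hle j
  let lE : ι → ℝ := fun e => lM (φ e) * V e
  have hlE : Matrix.vecMul lE E = ρ • lE := by
    ext f
    change ∑ e, lM (φ e) * V e * E e f = ρ * (lM (φ f) * V f)
    rw [← mul_assoc, ← hle', sum_mul]
    have : ∀ i, lM i * M i (φ f) * V f = ∑ e, if φ e = i then lM i * (V e * E e f) else 0 :=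
      fun i => by
        rw [mul_assoc, ← hV, mul_sum]
        simp only [mul_ite, mul_zero]
    simp only [this]
    rw [sum_comm]
    simp [mul_assoc]
  obtain ⟨hpos, hPE⟩ := PerronData.of_eigenvectors (M := E) (l := lE) (r := r) hE.nonempty hρ
    (fun e he => mul_pos (hlpos _ (Set.mem_image_of_mem φ he)) (hVpos e he))
    (fun e he => by simp [lE, hVz e he]) hrpos hrz hlE hre
  set rE := (lE ⬝ᵥ r)⁻¹ • r with hrE
  let rM : κ → ℝ := fun i => ∑ e, if φ e = i then V e * rE e else 0
  refine ⟨ρ, lE, rE, lM, rM, hPE, ⟨hρ, hlpos, hlz, ?_, ?_, hle, ?_, ?_⟩,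
    isLumped_of_left hV (fun _ => rfl) fun _ => rfl⟩
  · rintro _ ⟨e, he, rfl⟩
    refine sum_pos' (fun f _ => ?_) ⟨e, mem_univ _, ?_⟩
    · split_ifs
      · exact mul_nonneg (hV0 f) (hPE.right_nonneg f)
      · exact le_rfl
    · rw [if_pos rfl]
      exact mul_pos (hVpos e he) (hPE.right_pos e he)
  · intro i hi
    refine sum_eq_zero fun e _ => ?_
    split_ifs with h
    · rw [hVz e fun he => hi ⟨e, he, h⟩, zero_mul]
    · rfl
  · ext i
    change ∑ j, M i j * (∑ f, if φ f = j then V f * rE f else 0) =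
      ρ * ∑ e, if φ e = i then V e * rE e else 0
    simp only [mul_sum, mul_ite, mul_zero]
    rw [sum_comm]
    simp only [sum_ite_eq, mem_univ, if_true, ← mul_assoc, ← hV, sum_mul]
    rw [sum_comm]
    refine sum_congr rfl fun e _ => ?_
    by_cases he : φ e = i
    · simp only [he, if_true]
      rw [mul_right_comm, mul_comm (ρ * rE e), ← hPE.sum_right, mul_sum]
      exact sum_congr rfl fun f _ => by ring
    · simp [he]
  · rw [← hPE.dot]
    change ∑ i, lM i * (∑ e, if φ e = i then V e * rE e else 0) = ∑ e, lM (φ e) * V e * rE e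
    simp only [mul_sum, mul_ite, mul_zero]
    rw [sum_comm]
    simp [mul_assoc]

open Classical in
/-- The statement for column vectors, obtained from `exists_lumped_of_left` by time reversal. -/
theorem exists_lumped_of_right (hE : IrreducibleOn E S) (hV0 : ∀ e, 0 ≤ V e)
    (hVS : ∃ e ∈ S, 0 < V e) (hVz : ∀ e, e ∉ S → V e = 0)
    (hM : ∀ i j, M i j ≠ 0 → i ∈ φ '' S ∧ j ∈ φ '' S)
    (hV : ∀ e j, (∑ f, if φ f = j then E e f * V f else 0) = M (φ e) j * V e) :
    IrreducibleOn M (φ '' S) ∧ (∀ e f, E e f ≠ 0 → M (φ e) (φ f) ≠ 0) ∧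
    ∃ ρ lE rE lM rM, PerronData E S ρ lE rE ∧ PerronData M (φ '' S) ρ lM rM ∧
      IsLumped φ E lE rE M lM rM := by
  obtain ⟨h1, h2, ρ, lE, rE, lM, rM, h3, h4, h5⟩ :=
    exists_lumped_of_left (E := E.transpose) (M := M.transpose) (φ := φ) (V := V) hE.transpose hV0
      hVS hVz (fun i j hij => (hM j i hij).symm) (fun i f => by
        rw [Matrix.transpose_apply, ← hV]
        simp only [Matrix.transpose_apply, mul_comm])
  exact ⟨h1.transpose, fun e f hef => h2 f e hef, ρ, rE, lE, rM, lM, h3.transpose, h4.transpose,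
    h5.of_transpose⟩

theorem measurable_letterMap {ι κ : Type*} [MeasurableSpace ι] [DiscreteMeasurableSpace ι]
    [MeasurableSpace κ] (φ : ι → κ) : Measurable fun (x : ℕ → ι) i => φ (x i) :=
  measurable_pi_lambda _ fun i => Measurable.of_discrete.comp (measurable_pi_apply i)

variable [MeasurableSpace ι] [DiscreteMeasurableSpace ι] [MeasurableSpace κ]
  [DiscreteMeasurableSpace κ]

open Classical in
theorem real_cylinder_letterMap (μ : Measure (ℕ → ι)) [IsFiniteMeasure μ] (φ : ι → κ) {s : ℕ}
    (w : Fin s → κ) : (μ.map fun x i => φ (x i)).real (cylinder w) =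
      ∑ u : Fin s → ι, if φ ∘ u = w then μ.real (cylinder u) else 0 := by
  rw [map_measureReal_apply (measurable_letterMap φ) (measurableSet_cylinder w)]
  have h1 := integral_take μ (r := s) fun v => if φ ∘ v = w then 1 else 0
  simp only [mul_ite, mul_one, mul_zero] at h1
  rw [← h1]
  have h3 : (fun x : ℕ → ι => if φ ∘ take s x = w then (1 : ℝ) else 0) =
      ((fun (x : ℕ → ι) i => φ (x i)) ⁻¹' cylinder w).indicator 1 := by
    ext x
    simp only [Set.indicator_apply, Set.mem_preimage, mem_cylinder, Pi.one_apply]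
    rfl
  rw [h3, integral_indicator_one (measurable_letterMap φ (measurableSet_cylinder w))]

/-- The image of a Parry measure under a lumping is a Parry measure. -/
theorem IsLumped.hasParryCylinders (h : IsLumped φ E lE rE M lM rM) {μ : Measure (ℕ → ι)}
    [IsFiniteMeasure μ] (hμ : HasParryCylinders E ρ lE rE μ) :
    HasParryCylinders M ρ lM rM (μ.map fun x i => φ (x i)) := by
  classical
  intro s w
  rw [real_cylinder_letterMap, mul_assoc, mul_assoc, ← mul_assoc (lM _), ← h s w, mul_sum]
  refine sum_congr rfl fun u _ => ?_
  split_ifs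
  · rw [hμ]; ring
  · rw [mul_zero]

end Lumping

/-! ### The edge shift -/

section EdgeShift

theorem sum_edge {κ : Type*} [Fintype κ] (a : κ → κ → ℕ) (f : κ → κ → ℝ) :
    ∑ e : Edge a, f e.1 e.2.1 = ∑ i, ∑ j, a i j * f i j := by
  simp only [Fintype.sum_sigma, sum_const, card_univ, Fintype.card_fin, nsmul_eq_mul]

variable {κ : Type*} [Fintype κ] [MeasurableSpace κ] [DiscreteMeasurableSpace κ]
  {M : Matrix κ κ ℝ} {S : Set κ} {ρ : ℝ} {l r : κ → ℝ}

/-- The edge shift of the multigraph with adjacency matrix `M` has a unique measure of maximal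
entropy, which lies over the Parry measure of `M`. -/
theorem PerronData.exists_edgeShift_maximizer (h : PerronData M S ρ l r) (hM : IrreducibleOn M S)
    {μ : Measure (ℕ → κ)} [IsProbabilityMeasure μ] (hμ : HasParryCylinders M ρ l r μ)
    (a : κ → κ → ℕ) (ha : ∀ i j, M i j = a i j) :
    ∃ ζ, IsUniqueMaximizer (sft (edgeMatrix a)) entropy ζ ∧ ζ.map (vertexMap a) = μ := by
  classical
  have hne : ∀ e : Edge a, M e.1 e.2.1 ≠ 0 := fun e => by
    rw [ha]
    exact Nat.cast_ne_zero.2 (Fin.pos e.2.2).ne'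
  have hS := fun e : Edge a => hM.mem _ _ (hne e)
  have hE : ∀ e f : Edge a, edgeMatrix a e f = if e.2.1 = f.1 then 1 else 0 := fun e f => rfl
  have hedge : ∀ i j, M i j ≠ 0 → ∃ e : Edge a, e.1 = i ∧ e.2.1 = j := fun i j hij => by
    rw [ha, Nat.cast_ne_zero] at hij
    exact ⟨⟨i, j, ⟨0, Nat.pos_of_ne_zero hij⟩⟩, rfl, rfl⟩
  have hEirr : IrreducibleOn (edgeMatrix a) Set.univ := by
    refine ⟨fun e f => by rw [hE]; split_ifs <;> norm_num, fun _ _ _ => ⟨trivial, trivial⟩, ?_, ?_⟩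
    · intro e _ f _
      -- Follow a path of vertices from the end of `e` to the end of `f`, then adjust the last edge.
      have key : ∀ i j, Relation.TransGen (fun i j => M i j ≠ 0) i j → ∀ e : Edge a, e.2.1 = i →
          ∃ g : Edge a, g.2.1 = j ∧
            Relation.TransGen (fun e f => edgeMatrix a e f ≠ 0) e g := by
        intro i j hij e he
        induction hij with
        | @single j hj =>
          obtain ⟨g, hg1, hg2⟩ := hedge _ _ hj
          exact ⟨g, hg2, .single (by rw [hE, if_pos (he.trans hg1.symm)]; exact one_ne_zero)⟩
        | @tail b j _ hj ih =>
          obtain ⟨g, hg, hpath⟩ := ih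
          obtain ⟨g', hg1, hg2⟩ := hedge _ _ hj
          exact ⟨g', hg2, hpath.tail (by
            rw [hE, if_pos (hg.trans hg1.symm)]; exact one_ne_zero)⟩
      obtain ⟨g, hg, hpath⟩ := key _ _ (hM.conn _ (hS e).2 _ (hS f).1) e rfl
      exact hpath.tail (by rw [hE, if_pos hg]; exact one_ne_zero)
    · obtain ⟨i, hi⟩ := hM.nonempty
      obtain ⟨j, hj⟩ := hM.exists_succ hi
      obtain ⟨e, -⟩ := hedge i j hj
      exact ⟨e, trivial⟩
  have hρ := h.rho_pos.ne'
  have hPE : PerronData (edgeMatrix a) Set.univ ρ (fun e => l e.1 * ρ⁻¹) (fun e => r e.2.1) := by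
    refine ⟨h.rho_pos, fun e _ => mul_pos (h.left_pos _ (hS e).1) (inv_pos.2 h.rho_pos),
      fun e he => absurd trivial he, fun e _ => h.right_pos _ (hS e).2,
      fun e he => absurd trivial he, ?_, ?_, ?_⟩
    · ext f
      change ∑ e : Edge a, l e.1 * ρ⁻¹ * edgeMatrix a e f = ρ * (l f.1 * ρ⁻¹)
      simp only [hE]
      rw [sum_edge a fun i j => l i * ρ⁻¹ * if j = f.1 then 1 else 0]
      simp only [mul_ite, mul_one, mul_zero, sum_ite_eq', mem_univ, if_true, ← ha]
      rw [← mul_assoc, ← h.sum_left, sum_mul]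
      exact sum_congr rfl fun i _ => by ring
    · ext e
      change ∑ f : Edge a, edgeMatrix a e f * r f.2.1 = ρ * r e.2.1
      simp only [hE]
      rw [sum_edge a fun i j => (if e.2.1 = i then 1 else 0) * r j, ← h.sum_right]
      simp [← ha]
    · change ∑ e : Edge a, l e.1 * ρ⁻¹ * r e.2.1 = 1
      rw [sum_edge a fun i j => l i * ρ⁻¹ * r j, ← h.dot]
      change _ = ∑ i, l i * r i
      refine sum_congr rfl fun i _ => ?_
      have : r i = ρ⁻¹ * ∑ j, M i j * r j := by rw [h.sum_right]; field_simp
      rw [this, mul_sum, mul_sum]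
      exact sum_congr rfl fun j _ => by rw [ha]; ring
  obtain ⟨ζ, hζ, hζP⟩ := hPE.exists_measure hEirr
  have hlump : IsLumped (fun e : Edge a => e.1) (edgeMatrix a) (fun e => l e.1 * ρ⁻¹)
      (fun e => r e.2.1) M l r := by
    refine isLumped_of_left (V := fun _ => ρ⁻¹) (fun i f => ?_) (fun e => rfl) fun i => ?_
    · simp only [hE]
      rw [sum_edge a fun i' j => if i' = i then ρ⁻¹ * (if j = f.1 then 1 else 0) else 0]
      simp [← ha]
    · rw [sum_edge a fun i' j => if i' = i then ρ⁻¹ * r j else 0]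
      have : r i = ρ⁻¹ * ∑ j, M i j * r j := by rw [h.sum_right]; field_simp
      rw [this, mul_sum]
      simp only [mul_ite, mul_zero]
      rw [sum_comm]
      simp only [sum_ite_eq', mem_univ, if_true]
      exact sum_congr rfl fun j _ => by rw [ha]; ring
  have hmap := hlump.hasParryCylinders hζP
  have hprob : IsProbabilityMeasure (ζ.map (vertexMap a)) :=
    Measure.isProbabilityMeasure_map (measurable_letterMap fun e : Edge a => e.1).aemeasurable
  refine ⟨ζ, hPE.isUniqueMaximizer_entropy hEirr (fun e f hef => ?_) hζP, hμ.eq hmap⟩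
  rw [hE] at hef ⊢
  split_ifs at hef ⊢
  · rfl
  · exact absurd rfl hef

end EdgeShift

/-! ### Block presentations -/

section Blocks

variable {ι : Type*} {k : ℕ}

/-- The `k`-block presentation of a sequence over an arbitrary alphabet; for the alphabet `Fin n`
it is `blockMap`. -/
def blockSeq (k : ℕ) (x : ℕ → ι) : ℕ → (Fin k → ι) := fun i t => x (i + t)

/-- The `k`-block presentation of a word of length `r + k`. The length is a separate variable,
because it will also be needed in the form of a successor. -/
def blockWord {k r N : ℕ} (h : N = r + k) (v : Fin N → ι) : Fin (r + 1) → (Fin k → ι) :=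
  fun i t => v ⟨i + t, by omega⟩

theorem blockWord_injective (hk : 1 ≤ k) {r N : ℕ} (h : N = r + k) :
    Function.Injective (blockWord h : (Fin N → ι) → _) := by
  intro v v' hv
  ext ⟨j, hj⟩
  by_cases hjr : j ≤ r
  · exact congrFun (congrFun hv ⟨j, by omega⟩) ⟨0, hk⟩
  · have := congrFun (congrFun hv ⟨r, by omega⟩) ⟨j - r, by omega⟩
    simp only [blockWord] at this
    convert this using 3 <;> omega

theorem blockWord_take {r N : ℕ} (h : N = r + k) (x : ℕ → ι) :
    blockWord h (take N x) = take (r + 1) (blockSeq k x) := rfl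

theorem shift_blockSeq (x : ℕ → ι) : blockSeq k (shift x) = shift (blockSeq k x) := by
  funext i t
  simp only [blockSeq, shift]
  congr 1
  omega

variable [MeasurableSpace ι]

theorem measurable_blockSeq (k : ℕ) : Measurable (blockSeq k : (ℕ → ι) → _) :=
  measurable_pi_lambda _ fun _ => measurable_pi_lambda _ fun _ => measurable_pi_apply _

theorem IsInvariantOn.map {κ : Type*} [MeasurableSpace κ] {X : Set (ℕ → ι)} {X' : Set (ℕ → κ)}
    {η : Measure (ℕ → ι)} (h : IsInvariantOn X η) {f : (ℕ → ι) → (ℕ → κ)} (hf : Measurable f)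
    (hcomm : ∀ x, f (shift x) = shift (f x)) (hX' : MeasurableSet X') (hX : ∀ x ∈ X, f x ∈ X') :
    IsInvariantOn X' (η.map f) := by
  have := h.prob
  refine ⟨Measure.isProbabilityMeasure_map hf.aemeasurable, ⟨measurable_shift, ?_⟩, ?_⟩
  · rw [Measure.map_map measurable_shift hf]
    have : shift ∘ f = f ∘ shift := funext fun x => (hcomm x).symm
    rw [this, ← Measure.map_map hf measurable_shift, h.invariant.map_eq]
  · exact (ae_map_iff (p := fun y => y ∈ X') hf.aemeasurable hX').2 (h.supported.mono hX)

theorem map_blockSeq_injective (hk : 1 ≤ k) :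
    Function.Injective fun η : Measure (ℕ → ι) => η.map (blockSeq k) := by
  intro η η' h
  have hm : Measurable fun (x : ℕ → (Fin k → ι)) i => x i ⟨0, hk⟩ :=
    measurable_pi_lambda _ fun i => (measurable_pi_apply _).comp (measurable_pi_apply i)
  have := congrArg (fun m => Measure.map (fun (x : ℕ → (Fin k → ι)) i => x i ⟨0, hk⟩) m) h
  beta_reduce at this
  rw [Measure.map_map hm (measurable_blockSeq k),
    Measure.map_map hm (measurable_blockSeq k)] at this
  exact (Measure.map_id (μ := η)).symm.trans (this.trans Measure.map_id)

/-- Unique maximizers can be found in a block presentation. -/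
theorem IsUniqueMaximizer.of_blockSeq (hk : 1 ≤ k) {X : Set (ℕ → ι)}
    {X' : Set (ℕ → (Fin k → ι))} (hX' : MeasurableSet X') (hX : ∀ x ∈ X, blockSeq k x ∈ X')
    {F : Measure (ℕ → ι) → ℝ} {F' : Measure (ℕ → (Fin k → ι)) → ℝ}
    (hF : ∀ η, IsInvariantOn X η → F η = F' (η.map (blockSeq k))) {μ : Measure (ℕ → ι)}
    (hμ : IsInvariantOn X μ) (h : IsUniqueMaximizer X' F' (μ.map (blockSeq k))) :
    IsUniqueMaximizer X F μ := by
  refine ⟨hμ, fun η hη hne => ?_⟩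
  rw [hF η hη, hF μ hμ]
  exact h.2 _ (hη.map (measurable_blockSeq k) shift_blockSeq hX' hX)
    fun he => hne (map_blockSeq_injective hk he)

variable [Fintype ι] [DiscreteMeasurableSpace ι]

theorem real_cylinder_map_blockSeq (hk : 1 ≤ k) (η : Measure (ℕ → ι)) {r N : ℕ} (h : N = r + k)
    (v : Fin N → ι) :
    (η.map (blockSeq k)).real (cylinder (blockWord h v)) = η.real (cylinder v) := by
  rw [map_measureReal_apply (measurable_blockSeq k) (measurableSet_cylinder _)]
  congr 1
  ext x
  rw [Set.mem_preimage, mem_cylinder, mem_cylinder, ← blockWord_take h,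
    (blockWord_injective hk h).eq_iff]

theorem blockEntropy_map_blockSeq (hk : 1 ≤ k) (η : Measure (ℕ → ι)) {r N : ℕ} (h : N = r + k) :
    blockEntropy (η.map (blockSeq k)) (r + 1) = blockEntropy η N := by
  unfold blockEntropy
  symm
  refine Fintype.sum_of_injective (blockWord h) (blockWord_injective hk h) _ _ (fun w hw => ?_)
    fun v => ?_
  · have : blockSeq k ⁻¹' cylinder w = (∅ : Set (ℕ → ι)) := by
      refine Set.eq_empty_of_forall_notMem fun x hx => hw ⟨take N x, ?_⟩
      rw [blockWord_take]
      exact mem_cylinder.1 hx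
    rw [map_measureReal_apply (measurable_blockSeq k) (measurableSet_cylinder w), this]
    simp
  · rw [real_cylinder_map_blockSeq hk]

theorem entropy_map_blockSeq (hk : 1 ≤ k) {η : Measure (ℕ → ι)} [IsProbabilityMeasure η]
    (hη : MeasurePreserving shift η η) : entropy (η.map (blockSeq k)) = entropy η := by
  have h : IsInvariantOn Set.univ η := ⟨inferInstance, hη, by simp⟩
  have h' := h.map (measurable_blockSeq k) shift_blockSeq MeasurableSet.univ fun _ _ => trivial
  have := h'.prob
  have h1 := (tendsto_add_atTop_iff_nat 1).2 (tendsto_blockEntropy_succ_sub h'.invariant).1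
  have h2 := (tendsto_add_atTop_iff_nat k).2 (tendsto_blockEntropy_succ_sub hη).1
  refine tendsto_nhds_unique h1 (h2.congr fun r => ?_)
  rw [blockEntropy_map_blockSeq hk η (r := r + 1) (N := r + k + 1) (by omega),
    blockEntropy_map_blockSeq hk η (r := r) (N := r + k) rfl]

end Blocks

/-! ### Points and words of an irreducible subshift of finite type -/

section Points

variable {ι : Type*} {M : Matrix ι ι ℝ} {S : Set ι}

theorem shift_mem_sft {x : ℕ → ι} (hx : x ∈ sft M) : shift x ∈ sft M := fun i => hx (i + 1)

theorem mem_language {X : Set (ℕ → ι)} (hX : ∀ x ∈ X, shift x ∈ X) {r : ℕ} {w : Fin r → ι} :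
    w ∈ language X r ↔ ∃ x ∈ X, take r x = w := by
  constructor
  · rintro ⟨x, hx, s, hw⟩
    have : ∀ s, shift^[s] x ∈ X := fun s => by
      induction s with
      | zero => exact hx
      | succ s ih => rw [Function.iterate_succ_apply']; exact hX _ ih
    refine ⟨shift^[s] x, this s, funext fun t => ?_⟩
    rw [← hw t]
    simp only [take, iterate_shift_apply, add_comm]
  · rintro ⟨x, hx, rfl⟩
    exact ⟨x, hx, 0, fun t => by simp [take]⟩

theorem append_mem_sft {x y : ℕ → ι} {k : ℕ} (hx : ∀ i < k, M (x i) (x (i + 1)) ≠ 0)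
    (hy : y ∈ sft M) (hxy : x k = y 0) : (fun i => if i < k then x i else y (i - k)) ∈ sft M := by
  intro i
  beta_reduce
  rcases lt_trichotomy (i + 1) k with h | h | h
  · rw [if_pos (by omega), if_pos h]
    exact hx i (by omega)
  · rw [if_pos (by omega), if_neg (by omega)]
    have := hx i (by omega)
    rw [h, hxy] at this
    rwa [h, Nat.sub_self]
  · rw [if_neg (by omega), if_neg (by omega), show i + 1 - k = i - k + 1 by omega]
    exact hy _

theorem IrreducibleOn.exists_point (h : IrreducibleOn M S) {i : ι} (hi : i ∈ S) :
    ∃ x ∈ sft M, x 0 = i := by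
  have : ∀ a, ∃ b, a ∈ S → M a b ≠ 0 := fun a => by
    by_cases ha : a ∈ S
    · obtain ⟨b, hb⟩ := h.exists_succ ha
      exact ⟨b, fun _ => hb⟩
    · exact ⟨a, fun ha' => absurd ha' ha⟩
  choose f hf using this
  have hS : ∀ t, f^[t] i ∈ S := fun t => by
    induction t with
    | zero => exact hi
    | succ t ih => rw [Function.iterate_succ_apply']; exact (h.mem _ _ (hf _ ih)).2
  refine ⟨fun t => f^[t] i, fun t => ?_, rfl⟩
  beta_reduce
  rw [Function.iterate_succ_apply']
  exact hf _ (hS t)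

/-- Any initial word of `x` can be continued so that it eventually runs into `y`. -/
theorem IrreducibleOn.exists_connecting_point (h : IrreducibleOn M S) {x y : ℕ → ι}
    (hx : x ∈ sft M) (hy : y ∈ sft M) (k : ℕ) :
    ∃ z ∈ sft M, ∃ t > 0, take k z = take k x ∧ ∀ i, z (t + i) = y i := by
  have key : ∀ a, Relation.TransGen (fun a b => M a b ≠ 0) a (y 0) →
      ∃ z ∈ sft M, ∃ t > 0, z 0 = a ∧ ∀ i, z (t + i) = y i := by
    intro a ha
    induction ha using Relation.TransGen.head_induction_on with
    | @single a hab =>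
      refine ⟨_, append_mem_sft (x := fun i => if i = 0 then a else y 0) (k := 1) (fun i hi => ?_)
        hy rfl, 1, one_pos, rfl, fun i => ?_⟩
      · obtain rfl : i = 0 := by omega
        exact hab
      · rw [if_neg (by omega), Nat.add_sub_cancel_left]
    | @head a b hab _ ih =>
      obtain ⟨z, hz, t, ht, hz0, hzy⟩ := ih
      refine ⟨_, append_mem_sft (x := fun i => if i = 0 then a else b) (k := 1) (fun i hi => ?_)
        hz hz0.symm, t + 1, by omega, rfl, fun i => ?_⟩
      · obtain rfl : i = 0 := by omega
        exact hab
      · rw [if_neg (by omega), show t + 1 + i - 1 = t + i by omega, hzy]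
  obtain ⟨z, hz, t, ht, hz0, hzy⟩ := key (x k) (h.conn _ (h.mem _ _ (hx k)).1 _
    (h.mem _ _ (hy 0)).1)
  refine ⟨_, append_mem_sft (fun i _ => hx i) hz hz0.symm, k + t, by omega, ?_, fun i => ?_⟩
  · funext j
    simp only [take, j.2, if_true]
  · rw [if_neg (by omega), show k + t + i - k = t + i by omega, hzy]

end Points

/-! ### Higher block matrices of a carpet -/

section HigherBlock

variable {m n : ℕ} {A : Matrix (Fin m × Fin n) (Fin m × Fin n) ℝ} {k : ℕ}

theorem irreducibleOn_usedDigits (h01 : ∀ d d', A d d' = 0 ∨ A d d' = 1) (hA : A ≠ 0)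
    (hirr : (A.submatrix ((↑) : usedDigits A → Fin m × Fin n)
      ((↑) : usedDigits A → Fin m × Fin n)).IsIrreducible) :
    IrreducibleOn A (usedDigits A) := by
  refine ⟨fun d d' => ?_, fun d d' h => ⟨Or.inl ⟨d', h⟩, Or.inr ⟨d, h⟩⟩, fun d hd d' hd' => ?_, ?_⟩
  · rcases h01 d d' with h | h <;> simp [h]
  · let := Matrix.toQuiver (A.submatrix ((↑) : usedDigits A → Fin m × Fin n)
      ((↑) : usedDigits A → Fin m × Fin n))
    obtain ⟨p, hp⟩ := hirr.connected ⟨d, hd⟩ ⟨d', hd'⟩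
    have key : ∀ {b : usedDigits A} (p : Quiver.Path (⟨d, hd⟩ : usedDigits A) b), 0 < p.length →
        Relation.TransGen (fun a b => A a b ≠ 0) d b := by
      intro b p
      induction p with
      | nil => intro h; exact absurd h (lt_irrefl _)
      | @cons b c q e ih =>
        intro _
        have he : A b c ≠ 0 := e.down.ne'
        rcases Nat.eq_zero_or_pos q.length with hq | hq
        · have hb := Quiver.Path.eq_of_length_zero q hq
          subst hb
          exact .single he
        · exact (ih hq).tail he
    exact key p hp
  · by_contra hemp
    refine hA (Matrix.ext fun d d' => ?_)
    by_contra h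
    exact hemp ⟨d, Or.inl ⟨d', h⟩⟩

theorem higherBlock_zero_or_one (d d' : Fin k → Fin m × Fin n) :
    higherBlock A k d d' = 0 ∨ higherBlock A k d d' = 1 := by
  unfold higherBlock ind
  split_ifs <;> simp

theorem higherBlock_ne_zero_iff_word {d d' : Fin k → Fin m × Fin n} :
    higherBlock A k d d' ≠ 0 ↔ ∃ w : Fin (k + 1) → Fin m × Fin n,
    (∀ t : Fin k, A (w t.castSucc) (w t.succ) ≠ 0) ∧
      (∀ t : Fin k, w t.castSucc = d t) ∧ ∀ t : Fin k, w t.succ = d' t := by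
  unfold higherBlock ind
  split_ifs with h
  · simp [h]
  · simp [h]

theorem higherBlock_blockSeq {z : ℕ → Fin m × Fin n} (hz : z ∈ sft A) (i : ℕ) :
    higherBlock A k (blockSeq k z i) (blockSeq k z (i + 1)) ≠ 0 := by
  refine higherBlock_ne_zero_iff_word.2 ⟨fun t => z (i + t), fun t => hz _, fun t => rfl,
    fun t => ?_⟩
  simp only [blockSeq, Fin.val_succ]
  congr 1
  omega

theorem higherBlock_ne_zero_iff (hk : 1 ≤ k) {S : Set (Fin m × Fin n)} (hA : IrreducibleOn A S)
    {d d' : Fin k → Fin m × Fin n} :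
    higherBlock A k d d' ≠ 0 ↔ ∃ z ∈ sft A, take k z = d ∧ take k (shift z) = d' := by
  constructor
  · rw [higherBlock_ne_zero_iff_word]
    rintro ⟨w, hw, hwd, hwd'⟩
    obtain ⟨z, hz, hz0⟩ := hA.exists_point (i := w (Fin.last k)) (by
      have := hw ⟨k - 1, by omega⟩
      have e : (⟨k - 1, by omega⟩ : Fin k).succ = Fin.last k := by ext; simp; omega
      rw [e] at this
      exact (hA.mem _ _ this).2)
    let x : ℕ → Fin m × Fin n := fun i => if h : i < k + 1 then w ⟨i, h⟩ else w 0
    have hx : ∀ t : Fin (k + 1), x t = w t := fun t => dif_pos t.2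
    have hxk : x k = z 0 := by rw [hz0]; exact hx (Fin.last k)
    have hmem := append_mem_sft (x := x) (k := k) (fun i hi => by
      have := hw ⟨i, hi⟩
      rwa [← hx, ← hx] at this) hz hxk
    refine ⟨_, hmem, funext fun t => ?_, funext fun t => ?_⟩
    · rw [← hwd, ← hx]
      simp [take]
    · rw [← hwd', ← hx]
      simp only [take, shift, Fin.val_succ]
      split_ifs with h
      · rfl
      · have : (t : ℕ) + 1 = k := by omega
        rw [this, Nat.sub_self, hxk]
  · rintro ⟨z, hz, rfl, rfl⟩
    have := higherBlock_blockSeq (k := k) hz 0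
    have e1 : blockSeq k z 0 = take k z := by funext t; simp [blockSeq, take]
    have e2 : blockSeq k z (0 + 1) = take k (shift z) := by
      funext t; simp [blockSeq, take, shift, add_comm]
    rwa [e1, e2] at this

theorem IrreducibleOn.higherBlock (hk : 1 ≤ k) {S : Set (Fin m × Fin n)} (hA : IrreducibleOn A S) :
    IrreducibleOn (higherBlock A k) (language (sft A) k) := by
  have hlang : ∀ {d}, d ∈ language (sft A) k ↔ ∃ z ∈ sft A, take k z = d :=
    mem_language fun x hx => shift_mem_sft hx
  refine ⟨fun d d' => ?_, fun d d' h => ?_, fun d hd d' hd' => ?_, ?_⟩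
  · rcases higherBlock_zero_or_one (A := A) d d' with h | h <;> simp [h]
  · obtain ⟨z, hz, rfl, rfl⟩ := (higherBlock_ne_zero_iff hk hA).1 h
    exact ⟨hlang.2 ⟨z, hz, rfl⟩, hlang.2 ⟨_, shift_mem_sft hz, rfl⟩⟩
  · obtain ⟨x, hx, rfl⟩ := hlang.1 hd
    obtain ⟨y, hy, rfl⟩ := hlang.1 hd'
    obtain ⟨z, hz, t, ht, hzx, hzy⟩ := hA.exists_connecting_point hx hy k
    have e1 : take k x = blockSeq k z 0 := by rw [← hzx]; funext t; simp [blockSeq, take]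
    have e2 : take k y = blockSeq k z t := by funext i; exact (hzy i).symm
    rw [e1, e2]
    obtain ⟨t, rfl⟩ : ∃ s, t = s + 1 := ⟨t - 1, by omega⟩
    clear e2 hzy ht
    induction t with
    | zero => exact .single (higherBlock_blockSeq hz 0)
    | succ t ih => exact ih.tail (higherBlock_blockSeq hz (t + 1))
  · obtain ⟨i, hi⟩ := hA.nonempty
    obtain ⟨z, hz, -⟩ := hA.exists_point hi
    exact ⟨_, hlang.2 ⟨z, hz, rfl⟩⟩

theorem shift_mem_factorY {y : ℕ → Fin n} (hy : y ∈ factorY A) : shift y ∈ factorY A := by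
  obtain ⟨z, hz, rfl⟩ := hy
  exact ⟨shift z, shift_mem_sft hz, rfl⟩

/-- The second coordinates of a word of digits. -/
def projWord (d : Fin k → Fin m × Fin n) : Fin k → Fin n := fun t => (d t).2

theorem image_projWord_language :
    projWord '' language (sft A) k = language (factorY A) k := by
  ext J
  rw [mem_language fun y hy => shift_mem_factorY hy]
  constructor
  · rintro ⟨d, hd, rfl⟩
    obtain ⟨z, hz, rfl⟩ := (mem_language fun x hx => shift_mem_sft hx).1 hd
    exact ⟨projY z, ⟨z, hz, rfl⟩, rfl⟩
  · rintro ⟨_, ⟨z, hz, rfl⟩, rfl⟩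
    exact ⟨take k z, (mem_language fun x hx => shift_mem_sft hx).2 ⟨z, hz, rfl⟩, rfl⟩

open Classical in
theorem sum_projWord (J : Fin k → Fin n) (F : (Fin k → Fin m × Fin n) → ℝ) :
    (∑ d, if projWord d = J then F d else 0) = ∑ u, F (pairWord u J) := by
  rw [← (Equiv.arrowProdEquivProdArrow (Fin k) (fun _ => Fin m) (fun _ => Fin n)).symm.sum_comp,
    Fintype.sum_prod_type]
  refine sum_congr rfl fun u _ => ?_
  exact (sum_eq_single J (fun J' _ hJ' => if_neg hJ')
    fun hJ => absurd (mem_univ J) hJ).trans (if_pos rfl)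

open Classical in
/-- The vectors of a Markov condition as one function on words of digits, cut off outside the words
that occur in the carpet. -/
noncomputable def wordVector (A : Matrix (Fin m × Fin n) (Fin m × Fin n) ℝ)
    (V : (Fin k → Fin n) → (Fin k → Fin m) → ℝ) (d : Fin k → Fin m × Fin n) : ℝ :=
  if d ∈ language (sft A) k then V (projWord d) fun t => (d t).1 else 0

variable {V : (Fin k → Fin n) → (Fin k → Fin m) → ℝ} {c : (Fin k → Fin n) → (Fin k → Fin n) → ℝ}

theorem wordVector_nonneg (hV : IsAdmissibleFamily A k V) (d : Fin k → Fin m × Fin n) :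
    0 ≤ wordVector A V d := by
  unfold wordVector
  split_ifs with h
  · exact hV.nonneg _ (image_projWord_language ▸ Set.mem_image_of_mem _ h) _
  · exact le_rfl

theorem exists_wordVector_pos (hV : IsAdmissibleFamily A k V)
    (hne : (language (sft A) k).Nonempty) : ∃ d ∈ language (sft A) k, 0 < wordVector A V d := by
  obtain ⟨d, hd⟩ := hne
  obtain ⟨u, hu, hVu⟩ := hV.nonzero (projWord d)
    (image_projWord_language ▸ Set.mem_image_of_mem _ hd)
  refine ⟨_, hu, (wordVector_nonneg hV _).lt_of_ne' ?_⟩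
  rw [wordVector, if_pos hu]
  exact hVu

theorem coeffMatrix_mem {J J' : Fin k → Fin n} (h : coeffMatrix A k c J J' ≠ 0) :
    J ∈ projWord '' language (sft A) k ∧ J' ∈ projWord '' language (sft A) k := by
  rw [image_projWord_language]
  unfold coeffMatrix at h
  split_ifs at h with hJ
  · exact ⟨hJ.1, hJ.2.1⟩
  · exact absurd rfl h

/-- A transition of the higher block matrix lies above a transition counted in `coeffMatrix`. -/
theorem exists_word_of_higherBlock (hk : 1 ≤ k) {S : Set (Fin m × Fin n)}
    (hA : IrreducibleOn A S) {d d' : Fin k → Fin m × Fin n} (h : higherBlock A k d d' ≠ 0) :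
    projWord d ∈ language (factorY A) k ∧ projWord d' ∈ language (factorY A) k ∧
      ∃ w : Fin (k + 1) → Fin n, initWord w = projWord d ∧ tailWord w = projWord d' := by
  obtain ⟨h1, h2⟩ := (hA.higherBlock hk).mem _ _ h
  refine ⟨image_projWord_language ▸ Set.mem_image_of_mem _ h1,
    image_projWord_language ▸ Set.mem_image_of_mem _ h2, ?_⟩
  obtain ⟨z, hz, rfl, rfl⟩ := (higherBlock_ne_zero_iff hk hA).1 h
  exact ⟨take (k + 1) (projY z), rfl, rfl⟩

open Classical in
theorem MarkovLeft.sum_wordVector (h : MarkovLeft A k V c) (hk : 1 ≤ k) {S : Set (Fin m × Fin n)}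
    (hA : IrreducibleOn A S) (J : Fin k → Fin n) (f : Fin k → Fin m × Fin n) :
    (∑ d, if projWord d = J then wordVector A V d * higherBlock A k d f else 0) =
      coeffMatrix A k c J (projWord f) * wordVector A V f := by
  have hE := hA.higherBlock hk
  rw [sum_projWord J fun d => wordVector A V d * higherBlock A k d f]
  by_cases hf : f ∈ language (sft A) k
  swap
  · rw [wordVector, if_neg hf, mul_zero]
    refine sum_eq_zero fun u _ => ?_
    rw [by_contra fun hh => hf (hE.mem _ _ hh).2, mul_zero]
  by_cases hw : J ∈ language (factorY A) k ∧ projWord f ∈ language (factorY A) k ∧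
      ∃ w : Fin (k + 1) → Fin n, initWord w = J ∧ tailWord w = projWord f
  · have hc : coeffMatrix A k c J (projWord f) = c J (projWord f) := if_pos hw
    obtain ⟨hJ, hJ', w, rfl, hwf⟩ := hw
    have h1 := congrFun (h.transfer w hJ (hwf ▸ hJ')) fun t => (f t).1
    rw [hwf] at h1
    rw [hc, wordVector, if_pos hf]
    refine Eq.trans (sum_congr rfl fun u _ => ?_) h1
    have hfe : pairWord (fun t => (f t).1) (tailWord w) = f := by rw [hwf]; rfl
    change _ = V (initWord w) u *
      higherBlock A k (pairWord u (initWord w)) (pairWord _ (tailWord w))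
    rw [hfe]
    by_cases hz : higherBlock A k (pairWord u (initWord w)) f = 0
    · rw [hz, mul_zero, mul_zero]
    · rw [wordVector, if_pos (hE.mem _ _ hz).1]
      rfl
  · have hc : coeffMatrix A k c J (projWord f) = 0 := if_neg hw
    rw [hc, zero_mul]
    refine sum_eq_zero fun u _ => ?_
    rw [by_contra fun hh => hw (exists_word_of_higherBlock hk hA (d := pairWord u J) hh), mul_zero]

open Classical in
theorem MarkovRight.sum_wordVector (h : MarkovRight A k V c) (hk : 1 ≤ k)
    {S : Set (Fin m × Fin n)} (hA : IrreducibleOn A S) (e : Fin k → Fin m × Fin n)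
    (J : Fin k → Fin n) :
    (∑ d, if projWord d = J then higherBlock A k e d * wordVector A V d else 0) =
      coeffMatrix A k c (projWord e) J * wordVector A V e := by
  have hE := hA.higherBlock hk
  rw [sum_projWord J fun d => higherBlock A k e d * wordVector A V d]
  by_cases he : e ∈ language (sft A) k
  swap
  · rw [wordVector, if_neg he, mul_zero]
    refine sum_eq_zero fun u _ => ?_
    rw [by_contra fun hh => he (hE.mem _ _ hh).1, zero_mul]
  by_cases hw : projWord e ∈ language (factorY A) k ∧ J ∈ language (factorY A) k ∧
      ∃ w : Fin (k + 1) → Fin n, initWord w = projWord e ∧ tailWord w = J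
  · have hc : coeffMatrix A k c (projWord e) J = c (projWord e) J := if_pos hw
    obtain ⟨hJ, hJ', w, hwe, rfl⟩ := hw
    have h1 := congrFun (h.transfer w (hwe ▸ hJ) hJ') fun t => (e t).1
    rw [hwe] at h1
    rw [hc, wordVector, if_pos he]
    refine Eq.trans (sum_congr rfl fun u _ => ?_) h1
    have hee : pairWord (fun t => (e t).1) (initWord w) = e := by rw [hwe]; rfl
    change _ = higherBlock A k (pairWord _ (initWord w)) (pairWord u (tailWord w)) *
      V (tailWord w) u
    rw [hee]
    by_cases hz : higherBlock A k e (pairWord u (tailWord w)) = 0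
    · rw [hz, zero_mul, zero_mul]
    · rw [wordVector, if_pos (hE.mem _ _ hz).2]
      rfl
  · have hc : coeffMatrix A k c (projWord e) J = 0 := if_neg hw
    rw [hc, zero_mul]
    refine sum_eq_zero fun u _ => ?_
    rw [by_contra fun hh => hw (exists_word_of_higherBlock hk hA (d' := pairWord u J) hh), zero_mul]

/-- Under a Markov condition from either side, the higher block matrix lumps to `coeffMatrix`. -/
theorem exists_lumped_of_markov (hN : MarkovLeft A k V c ∨ MarkovRight A k V c) (hk : 1 ≤ k)
    {S : Set (Fin m × Fin n)} (hA : IrreducibleOn A S) :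
    IrreducibleOn (coeffMatrix A k c) (projWord '' language (sft A) k) ∧
    (∀ e f, higherBlock A k e f ≠ 0 → coeffMatrix A k c (projWord e) (projWord f) ≠ 0) ∧
    ∃ ρ lE rE lM rM, PerronData (higherBlock A k) (language (sft A) k) ρ lE rE ∧
      PerronData (coeffMatrix A k c) (projWord '' language (sft A) k) ρ lM rM ∧
      IsLumped projWord (higherBlock A k) lE rE (coeffMatrix A k c) lM rM := by
  have hE := hA.higherBlock hk
  have hz : ∀ d, d ∉ language (sft A) k → wordVector A V d = 0 := fun d hd => if_neg hd
  rcases hN with h | h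
  · exact exists_lumped_of_left hE (wordVector_nonneg h.family)
      (exists_wordVector_pos h.family hE.nonempty) hz (fun _ _ => coeffMatrix_mem)
      (fun i f => by convert h.sum_wordVector hk hA i f)
  · exact exists_lumped_of_right hE (wordVector_nonneg h.family)
      (exists_wordVector_pos h.family hE.nonempty) hz (fun _ _ => coeffMatrix_mem)
      (fun i f => by convert h.sum_wordVector hk hA i f)

end HigherBlock

/-! ### The energy of the induced potential -/

section Energy

theorem pathWeight_eq_ite {ι : Type*} {M : Matrix ι ι ℝ} (h01 : ∀ i j, M i j = 0 ∨ M i j = 1)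
    {s : ℕ} (w : Fin (s + 1) → ι) [Decidable (∀ t : Fin s, M (w t.castSucc) (w t.succ) ≠ 0)] :
    pathWeight M w = if ∀ t : Fin s, M (w t.castSucc) (w t.succ) ≠ 0 then 1 else 0 := by
  unfold pathWeight
  split_ifs with h
  · exact prod_eq_one fun t _ => (h01 _ _).resolve_left (h t)
  · push Not at h
    obtain ⟨t, ht⟩ := h
    exact prod_eq_zero (mem_univ t) ht

variable {m n : ℕ} {A : Matrix (Fin m × Fin n) (Fin m × Fin n) ℝ} {k : ℕ}

/-- The norm of the product of the potential along `J` counts the words of digits over `J`. -/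
theorem entrySum_potentialProd {s : ℕ} (J : Fin (s + 1) → Fin n) :
    entrySum (potentialProd A J) = ∑ u, pathWeight A (pairWord u J) := by
  have key : ∀ (s : ℕ) (J : Fin (s + 1) → Fin n) (g : Fin m → ℝ),
      ∑ p, (potentialProd A J).mulVec g p =
        ∑ u, pathWeight A (pairWord u J) * g (u (Fin.last s)) := by
    intro s
    induction s with
    | zero =>
      intro J g
      rw [← (Equiv.funUnique (Fin 1) (Fin m)).symm.sum_comp]
      simp only [potentialProd, List.ofFn_zero, List.prod_nil, Matrix.one_mulVec, pathWeight,
        univ_eq_empty, prod_empty, one_mul]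
      rfl
    | succ s ih =>
      intro J g
      obtain ⟨J, j, rfl⟩ : ∃ (J' : Fin (s + 1) → Fin n) (j : Fin n), J = Fin.snoc J' j :=
        ⟨Fin.init J, J (Fin.last _), (Fin.snoc_init_self J).symm⟩
      have hP : potentialProd A (Fin.snoc J j : Fin (s + 2) → Fin n) =
          potentialProd A J * inducedPotential A (J (Fin.last s)) j := by
        unfold potentialProd
        rw [List.ofFn_succ', List.concat_eq_append, List.prod_append, List.prod_singleton]
        simp only [Fin.snoc_castSucc, Fin.succ_castSucc, Fin.succ_last, Fin.snoc_last]
      rw [hP, ← Matrix.mulVec_mulVec, ih, sum_snoc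
        fun u => pathWeight A (pairWord u (Fin.snoc J j)) * g (u (Fin.last (s + 1)))]
      refine sum_congr rfl fun u _ => ?_
      change pathWeight A (pairWord u J) *
        ∑ q, inducedPotential A (J (Fin.last s)) j (u (Fin.last s)) q * g q = _
      rw [mul_sum]
      refine sum_congr rfl fun q _ => ?_
      have hpair : pairWord (Fin.snoc u q : Fin (s + 2) → Fin m) (Fin.snoc J j) =
          (Fin.snoc (pairWord u J) (q, j) : Fin (s + 2) → Fin m × Fin n) := by
        funext t
        refine Fin.lastCases ?_ (fun t => ?_) t
        · simp [pairWord]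
        · simp [pairWord]
      rw [hpair, pathWeight_snoc, Fin.snoc_last, mul_assoc]
      rfl
  have := key s J fun _ => 1
  simpa [entrySum, Matrix.mulVec, dotProduct] using this

/-- Both sides indicate that all transitions of `v` are allowed. -/
theorem pathWeight_blockWord (h01 : ∀ d d', A d d' = 0 ∨ A d d' = 1) (hk : 1 ≤ k) {q : ℕ}
    (h : q + k + 1 = q + 1 + k) (v : Fin (q + k + 1) → Fin m × Fin n) :
    pathWeight (higherBlock A k) (blockWord h v) = pathWeight A v := by
  classical
  rw [pathWeight_eq_ite higherBlock_zero_or_one, pathWeight_eq_ite h01]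
  refine if_congr ⟨fun hE t => ?_, fun hA t => ?_⟩ rfl rfl
  · have key : ∀ (i : ℕ) (hi : i < q + 1) (j : ℕ) (hj : j < k),
        A (v ⟨i + j, by omega⟩) (v ⟨i + j + 1, by omega⟩) ≠ 0 := by
      intro i hi j hj
      obtain ⟨w, hw, hw1, hw2⟩ := higherBlock_ne_zero_iff_word.1 (hE ⟨i, hi⟩)
      have := hw ⟨j, hj⟩
      rw [hw1, hw2] at this
      simp only [blockWord, Fin.val_castSucc, Fin.val_succ] at this
      have e : i + 1 + j = i + j + 1 := by omega
      simp only [e] at this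
      exact this
    by_cases ht : (t : ℕ) ≤ q
    · exact key t (by omega) 0 hk
    · have h1 := key q (by omega) (t - q) (by omega)
      have e : q + ((t : ℕ) - q) = t := by omega
      simp only [e] at h1
      exact h1
  · refine higherBlock_ne_zero_iff_word.2 ⟨fun i => v ⟨t + i, by omega⟩, fun j => ?_, fun j => rfl,
      fun j => ?_⟩
    · exact hA ⟨t + j, by omega⟩
    · simp only [blockWord, Fin.val_succ]
      congr 2
      omega

/-- On the finite set `S` the boundary factors of the Parry measure are bounded above and away from
zero. -/
theorem PerronData.exists_bound {ι : Type*} [Fintype ι] {M : Matrix ι ι ℝ} {S : Set ι} {ρ : ℝ}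
    {l r : ι → ℝ} (h : PerronData M S ρ l r) : ∃ C : ℝ, ∀ i ∈ S, ∀ j ∈ S,
      Real.exp (-C) ≤ l i * r j ∧ l i * r j ≤ Real.exp C := by
  refine ⟨∑ i, ∑ j, |Real.log (l i * r j)|, fun i hi j hj => ?_⟩
  have hpos := mul_pos (h.left_pos i hi) (h.right_pos j hj)
  have hle : |Real.log (l i * r j)| ≤ ∑ i, ∑ j, |Real.log (l i * r j)| :=
    (single_le_sum (f := fun j => |Real.log (l i * r j)|) (fun _ _ => abs_nonneg _)
      (mem_univ j)).trans
    (single_le_sum (f := fun i => ∑ j, |Real.log (l i * r j)|)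
      (fun _ _ => sum_nonneg fun _ _ => abs_nonneg _) (mem_univ i))
  rw [← Real.le_log_iff_exp_le hpos, ← Real.log_le_iff_le_exp hpos]
  exact abs_le.1 hle

variable {S : Set (Fin m × Fin n)} {M : Matrix (Fin k → Fin n) (Fin k → Fin n) ℝ} {ρ : ℝ}
  {lE rE : (Fin k → Fin m × Fin n) → ℝ} {lM rM : (Fin k → Fin n) → ℝ}
  {T : Set (Fin k → Fin n)} {μ : Measure (ℕ → Fin m × Fin n)}

theorem measurable_projY : Measurable (projY : (ℕ → Fin m × Fin n) → _) :=
  measurable_letterMap Prod.snd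

theorem blockSeq_mem_sft
    (hEM : ∀ e f, higherBlock A k e f ≠ 0 → M (projWord e) (projWord f) ≠ 0)
    {y : ℕ → Fin n} (hy : y ∈ factorY A) : blockSeq k y ∈ sft M := by
  obtain ⟨z, hz, rfl⟩ := hy
  exact fun i => hEM _ _ (higherBlock_blockSeq hz i)

/-- The norm of the product of the potential along a word and the product of the coefficients
along its `k`-block presentation agree up to a bounded factor, because either is proportional to
the measure of the same cylinder, up to a bounded factor. -/
theorem exists_abs_log_entrySum_sub_le (h01 : ∀ d d', A d d' = 0 ∨ A d d' = 1) (hk : 1 ≤ k)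
    (hA : IrreducibleOn A S) (hM : IrreducibleOn M T)
    (hEM : ∀ e f, higherBlock A k e f ≠ 0 → M (projWord e) (projWord f) ≠ 0)
    (hPE : PerronData (higherBlock A k) (language (sft A) k) ρ lE rE)
    (hPM : PerronData M T ρ lM rM) [IsProbabilityMeasure μ]
    (hμ : HasParryCylinders (higherBlock A k) ρ lE rE (μ.map (blockSeq k)))
    (hν : HasParryCylinders M ρ lM rM ((μ.map projY).map (blockSeq k))) :
    ∃ C : ℝ, ∀ y ∈ factorY A, ∀ q : ℕ,
      |Real.log (entrySum (potentialProd A (take (q + k + 1) y))) -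
        ∑ t : Fin (q + 1), Real.log (M (blockSeq k y t) (blockSeq k y (t + 1)))| ≤ C := by
  classical
  obtain ⟨C, hC⟩ := hPE.exists_bound
  obtain ⟨C', hC'⟩ := hPM.exists_bound
  refine ⟨C + C', fun y hy q => ?_⟩
  have hE := hA.higherBlock hk
  have hyM := blockSeq_mem_sft hEM hy
  have hlen : q + k + 1 = q + 1 + k := by omega
  have hA0 : ∀ d d', 0 ≤ A d d' := hA.nonneg
  set K := entrySum (potentialProd A (take (q + k + 1) y)) with hK
  have hρ : 0 < (ρ ^ (q + 1))⁻¹ := inv_pos.2 (pow_pos hPE.rho_pos _)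
  have hprob : IsProbabilityMeasure (μ.map projY) :=
    Measure.isProbabilityMeasure_map measurable_projY.aemeasurable
  set P := pathWeight M (take (q + 2) (blockSeq k y)) with hP
  have hJ : ∀ i, blockSeq k y i ∈ T := fun i => (hM.mem _ _ (hyM i)).1
  -- The measure of the cylinder of `y` in two ways.
  have e1 : (μ.map projY).real (cylinder (take (q + k + 1) y)) =
      (ρ ^ (q + 1))⁻¹ * (lM (blockSeq k y 0) * rM (blockSeq k y (q + 1)) * P) := by
    rw [← real_cylinder_map_blockSeq hk _ hlen, hν, blockWord_take]
    change _ * lM (blockSeq k y 0) * _ * rM (blockSeq k y (q + 1)) = _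
    ring
  have e2 : (μ.map projY).real (cylinder (take (q + k + 1) y)) =
      (ρ ^ (q + 1))⁻¹ * ∑ u, lE (blockWord hlen (pairWord u (take (q + k + 1) y)) 0) *
        rE (blockWord hlen (pairWord u (take (q + k + 1) y)) (Fin.last _)) *
        pathWeight A (pairWord u (take (q + k + 1) y)) := by
    have := real_cylinder_letterMap μ Prod.snd (take (q + k + 1) y)
    refine this.trans ?_
    refine Eq.trans ?_ ((sum_projWord (take (q + k + 1) y) fun v => μ.real (cylinder v)).trans ?_)
    · refine sum_congr rfl fun v _ => ?_
      by_cases hv : projWord v = take (q + k + 1) y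
      · exact (if_pos hv).trans (if_pos hv).symm
      · exact (if_neg hv).trans (if_neg hv).symm
    · rw [mul_sum]
      refine sum_congr rfl fun u _ => ?_
      rw [← real_cylinder_map_blockSeq hk _ hlen, hμ, pathWeight_blockWord h01 hk]
      ring
  have hbd : ∀ u, Real.exp (-C) * pathWeight A (pairWord u (take (q + k + 1) y)) ≤
        lE (blockWord hlen (pairWord u (take (q + k + 1) y)) 0) *
        rE (blockWord hlen (pairWord u (take (q + k + 1) y)) (Fin.last _)) *
        pathWeight A (pairWord u (take (q + k + 1) y)) ∧
        lE (blockWord hlen (pairWord u (take (q + k + 1) y)) 0) *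
        rE (blockWord hlen (pairWord u (take (q + k + 1) y)) (Fin.last _)) *
        pathWeight A (pairWord u (take (q + k + 1) y)) ≤
      Real.exp C * pathWeight A (pairWord u (take (q + k + 1) y)) := by
    intro u
    by_cases h0 : pathWeight A (pairWord u (take (q + k + 1) y)) = 0
    · simp [h0]
    have hnn := pathWeight_nonneg hA0 (pairWord u (take (q + k + 1) y))
    have hne := h0
    rw [← pathWeight_blockWord h01 hk hlen] at hne
    have hstep := fun t => prod_ne_zero_iff.1 hne t (mem_univ t)
    have hb := hC _ (hE.mem _ _ (hstep 0)).1 _ (hE.mem _ _ (hstep (Fin.last q))).2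
    exact ⟨mul_le_mul_of_nonneg_right hb.1 hnn, mul_le_mul_of_nonneg_right hb.2 hnn⟩
  have e3 := mul_left_cancel₀ hρ.ne' (e1.symm.trans e2)
  have hKsum : K = ∑ u, pathWeight A (pairWord u (take (q + k + 1) y)) := entrySum_potentialProd _
  have hlow : Real.exp (-C) * K ≤ lM (blockSeq k y 0) * rM (blockSeq k y (q + 1)) * P := by
    rw [e3, hKsum, mul_sum]
    exact sum_le_sum fun u _ => (hbd u).1
  have hup : lM (blockSeq k y 0) * rM (blockSeq k y (q + 1)) * P ≤ Real.exp C * K := by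
    rw [e3, hKsum, mul_sum]
    exact sum_le_sum fun u _ => (hbd u).2
  have hPpos : 0 < P := prod_pos fun t _ => (hM.nonneg _ _).lt_of_ne' (hyM t)
  have hb' := hC' _ (hJ 0) _ (hJ (q + 1))
  have hKpos : 0 < K := by
    refine pos_of_mul_pos_right (lt_of_lt_of_le ?_ hup) (Real.exp_pos C).le
    exact mul_pos (mul_pos (hPM.left_pos _ (hJ 0)) (hPM.right_pos _ (hJ (q + 1)))) hPpos
  have hlogP : ∑ t : Fin (q + 1), Real.log (M (blockSeq k y t) (blockSeq k y (t + 1))) =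
      Real.log P := by
    exact (Real.log_prod (s := univ)
      (f := fun t : Fin (q + 1) => M (blockSeq k y t) (blockSeq k y (t + 1))) fun t _ => hyM t).symm
  rw [hlogP, abs_le]
  have h1 : Real.exp (-C) * K ≤ Real.exp C' * P :=
    hlow.trans (mul_le_mul_of_nonneg_right hb'.2 hPpos.le)
  have h2 : Real.exp (-C') * P ≤ Real.exp C * K :=
    (mul_le_mul_of_nonneg_right hb'.1 hPpos.le).trans hup
  have h1' := Real.log_le_log (mul_pos (Real.exp_pos _) hKpos) h1
  have h2' := Real.log_le_log (mul_pos (Real.exp_pos _) hPpos) h2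
  rw [Real.log_mul (Real.exp_pos _).ne' hKpos.ne', Real.log_mul (Real.exp_pos _).ne' hPpos.ne',
    Real.log_exp, Real.log_exp] at h1' h2'
  constructor <;> linarith

theorem potentialEnergy_eq_integral {C : ℝ}
    (hC : ∀ y ∈ factorY A, ∀ q : ℕ,
      |Real.log (entrySum (potentialProd A (take (q + k + 1) y))) -
        ∑ t : Fin (q + 1), Real.log (M (blockSeq k y t) (blockSeq k y (t + 1)))| ≤ C)
    {η : Measure (ℕ → Fin n)} (hη : IsInvariantOn (factorY A) η) :
    potentialEnergy A η = ∫ x, Real.log (M (x 0) (x 1)) ∂(η.map (blockSeq k)) := by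
  have hprob := hη.prob
  have hη' : IsInvariantOn Set.univ η := ⟨hprob, hη.invariant, by simp⟩
  have hB := hη'.map (measurable_blockSeq k) shift_blockSeq MeasurableSet.univ fun _ _ => trivial
  have hBprob := hB.prob
  set I := ∫ x, Real.log (M (x 0) (x 1)) ∂(η.map (blockSeq k)) with hI
  have hmeas : ∀ t : ℕ, Integrable (fun x : ℕ → (Fin k → Fin n) => Real.log (M (x t) (x (t + 1))))
      (η.map (blockSeq k)) := fun t =>
    integrable_take _ (r := t + 2) fun v => Real.log (M (v (Fin.last t).castSucc) (v (Fin.last _)))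
  have hterm : ∀ t : ℕ, Integrable
      (fun y => Real.log (M (blockSeq k y t) (blockSeq k y (t + 1)))) η := fun t =>
    (hmeas t).comp_measurable (measurable_blockSeq k)
  have hIt : ∀ t : ℕ, ∫ y, Real.log (M (blockSeq k y t) (blockSeq k y (t + 1))) ∂η = I := by
    intro t
    have h1 : ∫ x, Real.log (M (x t) (x (t + 1))) ∂(η.map (blockSeq k)) = I := by
      have h2 := hB.invariant.iterate t
      rw [hI]
      conv_rhs => rw [← h2.map_eq]
      rw [integral_map h2.measurable.aemeasurable
        (by rw [h2.map_eq]; exact (hmeas 0).aestronglyMeasurable)]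
      simp only [iterate_shift_apply, zero_add, add_comm 1 t]
    rw [← h1, integral_map (measurable_blockSeq k).aemeasurable (hmeas t).aestronglyMeasurable]
  have hbound : ∀ q : ℕ, |(∫ y, Real.log (entrySum (potentialProd A (take (q + k + 1) y))) ∂η) -
      (q + 1) * I| ≤ C := by
    intro q
    have hint : Integrable (fun y => ∑ t : Fin (q + 1),
        Real.log (M (blockSeq k y t) (blockSeq k y (t + 1)))) η :=
      integrable_finsetSum _ fun t _ => hterm t
    have hsum : ∫ y, ∑ t : Fin (q + 1), Real.log (M (blockSeq k y t) (blockSeq k y (t + 1))) ∂η =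
        (q + 1) * I := by
      refine (integral_finsetSum (univ : Finset (Fin (q + 1))) fun t _ => hterm t).trans ?_
      simp [hIt]
    rw [← hsum, ← integral_sub
      (integrable_take η fun v : Fin (q + k + 1) → Fin n => Real.log (entrySum (potentialProd A v)))
      hint]
    have := norm_integral_le_of_norm_le_const (μ := η) (C := C)
      (f := fun y => Real.log (entrySum (potentialProd A (take (q + k + 1) y))) -
        ∑ t : Fin (q + 1), Real.log (M (blockSeq k y t) (blockSeq k y (t + 1))))
      (hη.supported.mono fun y hy => hC y hy q)
    simpa using this
  -- Only `q + 1` of the `q + k + 1` letters start a transition; the defect is bounded as well.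
  have hlim : Tendsto (fun q : ℕ =>
      (∫ y, Real.log (entrySum (potentialProd A (take (q + k + 1) y))) ∂η) /
        ((q + k : ℕ) + 1 : ℝ)) atTop (nhds I) := by
    have hden : Tendsto (fun q : ℕ => ((q + k : ℕ) + 1 : ℝ)) atTop atTop :=
      tendsto_atTop_add_const_right _ _
        (tendsto_natCast_atTop_atTop.comp (tendsto_add_atTop_nat k))
    have h0 : Tendsto (fun q : ℕ => (C + k * |I|) / ((q + k : ℕ) + 1 : ℝ)) atTop (nhds 0) :=
      hden.const_div_atTop _
    rw [← tendsto_sub_nhds_zero_iff]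
    refine squeeze_zero_norm (fun q => ?_) h0
    have hpos : (0 : ℝ) < (q + k : ℕ) + 1 := by positivity
    rw [Real.norm_eq_abs, div_sub' hpos.ne', abs_div, abs_of_pos hpos]
    refine div_le_div_of_nonneg_right ?_ hpos.le
    have h3 := hbound q
    have h4 : |(k : ℝ) * I| = k * |I| := by rw [abs_mul, Nat.abs_cast]
    rw [← h4]
    refine le_trans ?_ (add_le_add_left h3 _)
    refine le_trans (le_of_eq ?_) (abs_sub _ _)
    congr 1
    push_cast
    ring
  exact ((tendsto_add_atTop_iff_nat (f := fun s : ℕ =>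
    (∫ y, Real.log (entrySum (potentialProd A (take (s + 1) y))) ∂η) / ((s : ℝ) + 1)) k).1
      hlim).limsup_eq

end Energy

/-! ### Projection of the measure of maximal entropy -/

section Assembly

variable {m n : ℕ} {A : Matrix (Fin m × Fin n) (Fin m × Fin n) ℝ} {k : ℕ}

theorem measurableSet_factorY : MeasurableSet (factorY A) := by
  have hclosed : IsClosed (sft A) := by
    have : sft A = ⋂ i, (fun x : ℕ → Fin m × Fin n => (x i, x (i + 1))) ⁻¹'
        {p | A p.1 p.2 ≠ 0} := by
      ext x; simp [sft]
    rw [this]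
    exact isClosed_iInter fun i => (isClosed_discrete _).preimage (by fun_prop)
  have hcont : Continuous (projY : (ℕ → Fin m × Fin n) → _) :=
    continuous_pi fun i => continuous_snd.comp (continuous_apply i)
  exact (hclosed.isCompact.image hcont).isClosed.measurableSet

/-- A point of the subshift of the higher block matrix is the block presentation of the sequence
of its first letters. -/
theorem blockSeq_firstLetter (hk : 1 ≤ k) {x : ℕ → (Fin k → Fin m × Fin n)}
    (hx : x ∈ sft (higherBlock A k)) :
    (fun i => x i ⟨0, hk⟩) ∈ sft A ∧ blockSeq k (fun i => x i ⟨0, hk⟩) = x := by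
  constructor
  · intro i
    obtain ⟨w, hw, hw1, hw2⟩ := higherBlock_ne_zero_iff_word.1 (hx i)
    have := hw ⟨0, hk⟩
    rwa [hw1, hw2] at this
  · have key : ∀ (t : ℕ) (ht : t < k) (i : ℕ), x (i + t) ⟨0, hk⟩ = x i ⟨t, ht⟩ := by
      intro t
      induction t with
      | zero => intro _ i; rfl
      | succ t ih =>
        intro ht i
        obtain ⟨w, -, hw1, hw2⟩ := higherBlock_ne_zero_iff_word.1 (hx i)
        rw [show i + (t + 1) = i + 1 + t by omega, ih (by omega) (i + 1), ← hw1, ← hw2]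
        rfl
    funext i t
    exact key t t.2 i

end Assembly

end Carpet

open Carpet in
theorem theorem1p4 {m n : ℕ} (A : Matrix (Fin m × Fin n) (Fin m × Fin n) ℝ)
    (h01 : ∀ d d', A d d' = 0 ∨ A d d' = 1) (hA : A ≠ 0)
    (hirr : (A.submatrix ((↑) : usedDigits A → Fin m × Fin n)
      ((↑) : usedDigits A → Fin m × Fin n)).IsIrreducible)
    (k : ℕ) (hk : 1 ≤ k)
    (V : (Fin k → Fin n) → (Fin k → Fin m) → ℝ)
    (c : (Fin k → Fin n) → (Fin k → Fin n) → ℝ)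
    (hN : MarkovLeft A k V c ∨ MarkovRight A k V c) :
    ∃ ν : MeasureTheory.Measure (ℕ → Fin n),
      IsUniqueEquilibrium A ν ∧
      (∃ μ, IsUniqueMaximizer (sft A) entropy μ ∧ μ.map projY = ν) ∧
      (∀ J J', 0 ≤ coeffMatrix A k c J J') ∧
      IsUniqueMaximizer (sft (coeffMatrix A k c)) (weightedEntropy (coeffMatrix A k c))
        (ν.map (blockMap k)) ∧
      IsParryMeasure (coeffMatrix A k c) (ν.map (blockMap k)) ∧
      ∀ a : (Fin k → Fin n) → (Fin k → Fin n) → ℕ, (∀ J J', coeffMatrix A k c J J' = a J J') →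
        ∃ ζ, IsUniqueMaximizer (sft (edgeMatrix a)) entropy ζ ∧
          ζ.map (vertexMap a) = ν.map (blockMap k) := by
  have hAirr := irreducibleOn_usedDigits h01 hA hirr
  have hE := hAirr.higherBlock hk
  obtain ⟨hM, hEM, ρ, lE, rE, lM, rM, hPE, hPM, hlump⟩ := exists_lumped_of_markov hN hk hAirr
  obtain ⟨μE, hμE, hμEP⟩ := hPE.exists_measure hE
  have hμEinv := hPE.isInvariantOn hμEP
  let fst : (ℕ → (Fin k → Fin m × Fin n)) → (ℕ → Fin m × Fin n) := fun x i => x i ⟨0, hk⟩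
  have hfst : Measurable fst := measurable_letterMap fun d : Fin k → Fin m × Fin n => d ⟨0, hk⟩
  -- `μE` lives on block presentations, so nothing is lost by keeping only the first letters.
  let μ := μE.map fst
  have hμinv : IsInvariantOn (sft A) μ := hμEinv.map hfst (fun _ => rfl) (measurableSet_sft A)
    fun x hx => (blockSeq_firstLetter hk hx).1
  have hμprob := hμinv.prob
  have hμblock : μ.map (blockSeq k) = μE := by
    rw [MeasureTheory.Measure.map_map (measurable_blockSeq k) hfst]
    refine (MeasureTheory.Measure.map_congr ?_).trans MeasureTheory.Measure.map_id
    exact hμEinv.supported.mono fun x hx => (blockSeq_firstLetter hk hx).2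
  have hμP : HasParryCylinders (higherBlock A k) ρ lE rE (μ.map (blockSeq k)) := by rwa [hμblock]
  let ν := μ.map projY
  have hνinv : IsInvariantOn (factorY A) ν := hμinv.map measurable_projY (fun _ => rfl)
    measurableSet_factorY fun z hz => ⟨z, hz, rfl⟩
  have hνprob := hνinv.prob
  have hνblock : ν.map (blockSeq k) = μE.map fun x i => projWord (x i) := by
    rw [MeasureTheory.Measure.map_map (measurable_blockSeq k) measurable_projY, ← hμblock,
      MeasureTheory.Measure.map_map (measurable_letterMap projWord) (measurable_blockSeq k)]
    rfl
  have hνP : HasParryCylinders (coeffMatrix A k c) ρ lM rM (ν.map (blockSeq k)) := by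
    rw [hνblock]
    exact hlump.hasParryCylinders hμEP
  have hνblockprob : MeasureTheory.IsProbabilityMeasure (ν.map (blockSeq k)) :=
    MeasureTheory.Measure.isProbabilityMeasure_map (measurable_blockSeq k).aemeasurable
  have hmaxM := hPM.isUniqueMaximizer hM hνP
  obtain ⟨C, hC⟩ := exists_abs_log_entrySum_sub_le h01 hk hAirr hM hEM hPE hPM hμP hνP
  refine ⟨ν, ?_, ⟨μ, ?_, rfl⟩, hM.nonneg, hmaxM, ?_, ?_⟩
  · refine IsUniqueMaximizer.of_blockSeq hk (measurableSet_sft (coeffMatrix A k c))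
      (fun y hy => blockSeq_mem_sft hEM hy) (fun η hη => ?_) hνinv hmaxM
    have := hη.prob
    rw [potentialEnergy_eq_integral hC hη, ← entropy_map_blockSeq hk hη.invariant]
    rfl
  · refine IsUniqueMaximizer.of_blockSeq hk (measurableSet_sft (higherBlock A k))
      (fun z hz => higherBlock_blockSeq hz) (fun η hη => ?_) hμinv
      (F' := entropy) ?_
    · have := hη.prob
      exact (entropy_map_blockSeq hk hη.invariant).symm
    · rw [hμblock]
      exact hPE.isUniqueMaximizer_entropy hE
        (fun d d' hd => (higherBlock_zero_or_one d d').resolve_left hd) hμEP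
  · exact ⟨ρ, lM, rM, hPM.rho_pos, hPM.left_nonneg, hPM.right_nonneg, hPM.left_eq, hPM.right_eq,
      hPM.dot, hνP⟩
  · exact fun a ha => hPM.exists_edgeShift_maximizer hM hνP a ha
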